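/- Call a set $F$ of non-edges of a finite simple graph $G=(V,E)$ a chordal completion of $G$ if the graph $(V,E\cup F)$ is chordal, that is, has no induced cycle of length at least $4$; a minimal chordal completion is one that is minimal with respect to inclusion. Theorem. There exists an algorithm that enumerates the minimal chordal completions of a graph with polynomial delay, using exponential space. That is, there are a single program and polynomials $p,q$ such that, for every graph $G$ on $n$ vertices, given by its adjacency matrix, the program outputs every minimal chordal completion of $G$ exactly once and nothing else, and then halts; at most $p(n)$ computation steps pass before the first output, between any two consecutive outputs, and between the last output and the halt; and at most $2^{q(n)}$ memory cells are used. (The machine model consists of WHILE-programs over immutable binary trees: variables hold pointers to trees; evaluating an expression built from variables, nil, cons, head and tail costs one step per symbol; the only test is whether a tree is nil; each assignment, test and output costs one further step; and outputting a tree costs in addition its number of nodes. This model is equivalent to the random-access machine up to polynomial overhead per step in the length of its addresses.) -/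

import Mathlib

/-! ## Chordal graphs and minimal chordal completions -/

/-- A graph is chordal if it has no induced cycle of length `4` or more. -/
def IsChordalGraph {V : Type*} (H : SimpleGraph V) : Prop :=
  ∀ k : ℕ, 4 ≤ k → ¬ (SimpleGraph.cycleGraph k).IsIndContained H

/-- A set `F` of non-edges of `G` is a chordal completion of `G` if adding the edges of `F` to `G`
gives a chordal graph. -/
def IsChordalCompletion {V : Type*} (G : SimpleGraph V) (F : Set (Sym2 V)) : Prop :=
  F ⊆ Gᶜ.edgeSet ∧ IsChordalGraph (G ⊔ SimpleGraph.fromEdgeSet F)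

/-- An inclusion-wise minimal chordal completion. -/
def IsMinimalChordalCompletion {V : Type*} (G : SimpleGraph V) (F : Set (Sym2 V)) : Prop :=
  Minimal (IsChordalCompletion G) F

/-! ## The machine model

WHILE-programs over binary trees (LISP cells).  A variable holds a pointer to an immutable binary
tree; evaluating an expression costs one step per node of the expression, as each of `nil`, a
variable access, `cons` (allocation of one cell), `hd` and `tl` is a constant-time pointer
operation. The only test is whether a tree is `nil`. -/

namespace TreeProg

/-- Binary trees: `nil`, or a cell with two pointers. -/
inductive Data : Type
  | nil : Data
  | cons : Data → Data → Data

namespace Data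

/-- The number of nodes of a tree. -/
def size : Data → ℕ
  | nil => 1
  | cons a b => 1 + a.size + b.size

/-- First component of a cell (`nil` for `nil`). -/
def hd : Data → Data
  | nil => nil
  | cons a _ => a

/-- Second component of a cell (`nil` for `nil`). -/
def tl : Data → Data
  | nil => nil
  | cons _ b => b

/-- Lists as right-nested, `nil`-terminated cells. -/
def ofList : List Data → Data
  | [] => nil
  | a :: l => cons a (ofList l)

/-- Booleans: `false` is `nil`, `true` is a cell. -/
def ofBool : Bool → Data
  | false => nil
  | true => cons nil nil

end Data

/-- Expressions; the variables are numbered by natural numbers. -/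
inductive Expr : Type
  | nil : Expr
  | var : ℕ → Expr
  | cons : Expr → Expr → Expr
  | hd : Expr → Expr
  | tl : Expr → Expr

namespace Expr

/-- The value of an expression. -/
def eval (σ : ℕ → Data) : Expr → Data
  | nil => Data.nil
  | var x => σ x
  | cons a b => Data.cons (a.eval σ) (b.eval σ)
  | hd a => (a.eval σ).hd
  | tl a => (a.eval σ).tl

/-- The number of steps needed to evaluate an expression. -/
def cost : Expr → ℕ
  | nil => 1
  | var _ => 1
  | cons a b => 1 + a.cost + b.cost
  | hd a => 1 + a.cost
  | tl a => 1 + a.cost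

/-- The number of memory cells allocated when an expression is evaluated. -/
def allocs : Expr → ℕ
  | nil => 0
  | var _ => 0
  | cons a b => 1 + a.allocs + b.allocs
  | hd a => a.allocs
  | tl a => a.allocs

end Expr

/-- Programs. -/
inductive Cmd : Type
  | skip : Cmd
  | assign : ℕ → Expr → Cmd
  | output : Expr → Cmd
  | seq : Cmd → Cmd → Cmd
  | ite : Expr → Cmd → Cmd → Cmd
  | loop : Expr → Cmd → Cmd

/-- A state: the variables, the number of steps made so far, the number of cells allocated so far,
and the outputs made so far in chronological order, each with the time at which it was completed. -/
structure State : Type where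
  vars : ℕ → Data
  time : ℕ
  cells : ℕ
  out : List (ℕ × Data)

namespace State

/-- The initial state: variable `0` holds the input, every other variable holds `nil`. -/
def init (d : Data) : State where
  vars := fun x => if x = 0 then d else Data.nil
  time := 0
  cells := 0
  out := []

/-- The value of an expression in a state. -/
def value (s : State) (e : Expr) : Data := e.eval s.vars

/-- The state after the evaluation of `e`, charging its steps and one step of control,
and its allocations. -/
def charge (s : State) (e : Expr) : State where
  vars := s.vars
  time := s.time + (1 + e.cost)
  cells := s.cells + e.allocs
  out := s.out

/-- The effect of `x := e`. -/
def assign (s : State) (x : ℕ) (e : Expr) : State where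
  vars := Function.update s.vars x (s.value e)
  time := s.time + (1 + e.cost)
  cells := s.cells + e.allocs
  out := s.out

/-- The effect of outputting the value of `e`. Writing a tree costs as many steps as it has
nodes. -/
def output (s : State) (e : Expr) : State where
  vars := s.vars
  time := s.time + (1 + e.cost + (s.value e).size)
  cells := s.cells + e.allocs
  out := s.out ++ [(s.time + (1 + e.cost + (s.value e).size), s.value e)]

end State

/-- `Exec c s t`: the program `c`, started in the state `s`, halts in the state `t`
(a deterministic big-step semantics). `ite e` branches, and `loop e` goes on, according to whether
the value of `e` is different from `nil`. -/
inductive Exec : Cmd → State → State → Prop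
  | skip (s : State) : Exec Cmd.skip s s
  | assign (x : ℕ) (e : Expr) (s : State) : Exec (Cmd.assign x e) s (s.assign x e)
  | output (e : Expr) (s : State) : Exec (Cmd.output e) s (s.output e)
  | seq {c d : Cmd} {s t u : State} :
      Exec c s t → Exec d t u → Exec (Cmd.seq c d) s u
  | ite_true {e : Expr} {c d : Cmd} {s t : State} :
      s.value e ≠ Data.nil → Exec c (s.charge e) t → Exec (Cmd.ite e c d) s t
  | ite_false {e : Expr} {c d : Cmd} {s t : State} :
      s.value e = Data.nil → Exec d (s.charge e) t → Exec (Cmd.ite e c d) s t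
  | loop_stop {e : Expr} {c : Cmd} {s : State} :
      s.value e = Data.nil → Exec (Cmd.loop e c) s (s.charge e)
  | loop_step {e : Expr} {c : Cmd} {s t u : State} :
      s.value e ≠ Data.nil → Exec c (s.charge e) t → Exec (Cmd.loop e c) t u →
      Exec (Cmd.loop e c) s u

/-- In the run that halts in the state `s`, at most `d` steps pass before the first output, between
any two consecutive outputs, and from the last output (from the start, if there is none) to the
halt. -/
def HasDelay (d : ℕ) (s : State) : Prop :=
  List.IsChain (fun a b : ℕ => b ≤ a + d) (0 :: (s.out.map Prod.fst ++ [s.time]))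

open Classical in
/-- The encoding of a graph on `{0, …, n-1}`: its adjacency matrix, as the list of its rows. -/
noncomputable def encodeGraph {n : ℕ} (H : SimpleGraph (Fin n)) : Data :=
  Data.ofList (List.ofFn fun i : Fin n =>
    Data.ofList (List.ofFn fun j : Fin n => Data.ofBool (decide (H.Adj i j))))

/-- A set of vertex pairs is encoded as the graph whose edges are these pairs. -/
noncomputable def encodeEdges {n : ℕ} (F : Set (Sym2 (Fin n))) : Data :=
  encodeGraph (SimpleGraph.fromEdgeSet F)

end TreeProg

/-! Minimal completions of `G` correspond to minimal chordal supergraphs `H` of `G` via `H \ G`.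
They are enumerated by searching a digraph on these graphs. The successor of `H` along a fill edge
`xy` is obtained by completing the common neighbourhood of `x` and `y`, deleting `xy`, and then
deleting further fill edges until the result is minimal.

Two facts drive this. By `IsChordalGraph.flip`, completing and deleting keeps a graph chordal. By
`exists_commonClique`, for chordal `T < K` some edge of `K` outside `T` has a complete common
neighbourhood, so the flip of `K` just deletes it. The second fact makes greedy deletion end in a
minimal graph. It also reaches every target `T` (`mem_of_neighbor_closed`): descend from the
complete graph to `T` through chordal graphs `K`, one edge at a time, always keeping a visited graph
below `K`. Flips are monotone, so if the deleted edge lies in the visited graph, the successor along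
it lies below the new `K`. At `K = T`, minimality of `T` identifies the visited graph with `T`.

The search keeps a stack and a trie of adjacency matrices of depth `n * n`. Between two outputs it
makes one expansion, which is polynomial because successors and trie accesses are. The combinators
for `Computes` build the program and its time bound together. There are at most `2 ^ (n * n)`
outputs, so polynomial delay bounds the total time exponentially, and time bounds space
(`Exec.cells_le`). -/

namespace SimpleGraph

/-! ### Chordality and simplicial vertices -/

variable {V : Type*}

/-- The neighbours of `v ∈ S` within `S` form a clique. -/
def IsSimplicialIn (H : SimpleGraph V) (S : Finset V) (v : V) : Prop :=
  v ∈ S ∧ ∀ a ∈ S, ∀ b ∈ S, H.Adj v a → H.Adj v b → a ≠ b → H.Adj a b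

/-- A cyclic sequence in which exactly the consecutive elements are adjacent gives an induced cycle. -/
theorem cycleGraph_isIndContained_of_seq (H : SimpleGraph V) (k : ℕ) (f : ℕ → V)
    (inj : ∀ i j, i < j → j < k → f i ≠ f j)
    (adj : ∀ i j, i < j → j < k → (H.Adj (f i) (f j) ↔ j = i + 1 ∨ (i = 0 ∧ j + 1 = k))) :
    (cycleGraph k).IsIndContained H := by
  have key : ∀ i j : Fin k, i < j →
      (H.Adj (f i) (f j) ↔ (cycleGraph k).Adj i j) := by
    intro i j hij
    rw [adj i j hij j.2, cycleGraph_adj', Fin.coe_sub_iff_lt.mpr hij, Fin.coe_sub_iff_le.mpr hij.le]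
    have := j.2
    have : i.val < j.val := hij
    omega
  refine ⟨⟨⟨fun i : Fin k => f i, ?_⟩, ?_⟩⟩
  · intro i j h
    rcases lt_trichotomy i j with h' | h' | h'
    · exact absurd h (inj i j h' j.2)
    · exact h'
    · exact absurd h.symm (inj j i h' i.2)
  · intro i j
    rcases lt_trichotomy i j with h' | h' | h'
    · exact key i j h'
    · simp [h']
    · rw [adj_comm, (cycleGraph k).adj_comm]
      exact key j i h'

/-- The edges of `H` inside `D`. -/
def within (H : SimpleGraph V) (D : Set V) : SimpleGraph V where
  Adj u v := H.Adj u v ∧ u ∈ D ∧ v ∈ D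
  symm := ⟨fun _ _ h => ⟨h.1.symm, h.2.2, h.2.1⟩⟩
  loopless := ⟨fun _ h => H.loopless.irrefl _ h.1⟩

/-- Two non-adjacent neighbours of `a` joined by a path avoiding the neighbourhood of `a` lie on an
induced cycle of length at least four. -/
theorem not_isChordalGraph_of_reachable (H : SimpleGraph V) (a z w : V) (C : Set V)
    (haz : H.Adj a z) (haw : H.Adj a w) (hzw : z ≠ w) (hnzw : ¬ H.Adj z w)
    (haC : ∀ c ∈ C, c ≠ a ∧ ¬ H.Adj a c)
    (hr : (H.within (C ∪ {z, w})).Reachable z w) : ¬ IsChordalGraph H := by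
  set Q := H.within (C ∪ {z, w}) with hQ
  -- A shortest path from `z` to `w` has no chords, and its interior lies in `C`, away from the
  -- neighbours of `a`; adding `a` closes it to an induced cycle on `m + 2` vertices.
  obtain ⟨p, hp⟩ := hr.exists_walk_length_eq_dist
  set m := p.length with hm
  have hdist : ∀ i ≤ m, Q.dist z (p.getVert i) = i := by
    intro i hi
    rw [← length_eq_dist_of_subwalk hp (p.isSubwalk_take i), Walk.take_length]
    omega
  have hm2 : 2 ≤ m := by
    have : 1 < Q.dist z w := hr.one_lt_dist_of_ne_of_not_adj hzw (fun h => hnzw h.1)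
    omega
  have hsucc : ∀ i < m, Q.Adj (p.getVert i) (p.getVert (i+1)) := fun i hi => p.adj_getVert_succ hi
  have hmem : ∀ i ≤ m, p.getVert i ∈ C ∪ {z, w} := by
    intro i hi
    rcases hi.lt_or_eq with h | h
    · exact (hsucc i h).2.1
    · rw [h, hm, p.getVert_length]; simp
  have h0 : p.getVert 0 = z := p.getVert_zero
  have hmw : p.getVert m = w := p.getVert_length
  have hint : ∀ i, 0 < i → i < m → p.getVert i ∈ C := by
    intro i h1 h2
    have hd := hdist i h2.le
    rcases hmem i h2.le with h | h | h
    · exact h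
    · rw [h, dist_self] at hd; omega
    · have h' : p.getVert i = w := h
      rw [h', ← hp] at hd; omega
  have hnadj : ∀ i j, i + 1 < j → j ≤ m → ¬ H.Adj (p.getVert i) (p.getVert j) := by
    intro i j h1 h2 h
    have hq : Q.Adj (p.getVert i) (p.getVert j) := ⟨h, hmem i (by omega), hmem j h2⟩
    have := hq.diff_dist_adj (u := z)
    rw [hdist i (by omega), hdist j h2] at this
    omega
  have hpa : ∀ i ≤ m, p.getVert i ≠ a := by
    intro i hi h
    rcases Nat.eq_zero_or_pos i with rfl | h1
    · rw [h0] at h; exact haz.ne h.symm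
    rcases hi.lt_or_eq with h2 | rfl
    · exact (haC _ (hint i h1 h2)).1 h
    · rw [hmw] at h; exact haw.ne h.symm
  intro hch
  refine hch (m + 2) (by omega) (cycleGraph_isIndContained_of_seq H (m + 2)
    (fun i => if i ≤ m then p.getVert i else a) ?_ ?_)
  · intro i j hij hj
    have hi : i ≤ m := by omega
    simp only [hi, if_true]
    split_ifs with hjm
    · intro h
      have := hdist i hi
      rw [h, hdist j hjm] at this
      omega
    · exact hpa i hi
  · intro i j hij hj
    have hi : i ≤ m := by omega
    simp only [hi, if_true]
    split_ifs with hjm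
    · constructor
      · intro h
        by_contra hc
        exact hnadj i j (by omega) hjm h
      · intro h
        obtain rfl : j = i + 1 := by omega
        exact (hsucc i (by omega)).1
    · constructor
      · intro h
        by_contra hc
        have h1 : 0 < i := by omega
        have h2 : i < m := by omega
        exact (haC _ (hint i h1 h2)).2 h.symm
      · intro h
        rcases h with h | h
        · obtain rfl : i = m := by omega
          rw [hmw]; exact haw.symm
        · obtain rfl := h.1
          rw [h0]; exact haz.symm

open Classical in
/-- In a chordal graph, every vertex set not covered by a given clique has a simplicial vertex
outside that clique. -/
theorem IsChordalGraph.exists_isSimplicialIn {H : SimpleGraph V} (hH : IsChordalGraph H)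
    (S : Finset V) (K : Set V) (hK : K.Pairwise H.Adj) (hSK : ∃ v ∈ S, v ∉ K) :
    ∃ v, v ∉ K ∧ H.IsSimplicialIn S v := by
  induction S using Finset.strongInduction generalizing K with
  | H S ih =>
  by_cases hcl : ∀ a ∈ S, ∀ b ∈ S, a ≠ b → H.Adj a b
  · obtain ⟨v, hv, hvK⟩ := hSK
    exact ⟨v, hvK, hv, fun a ha b hb _ _ h => hcl a ha b hb h⟩
  -- The vertex `a` is taken in `K` if some vertex of `K` in `S` has a non-neighbour in `S`.
  -- Otherwise all vertices of `K` in `S` are adjacent to the rest of `S`, and any `a` with a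
  -- non-neighbour will do.
  have hex : ∃ a ∈ S, (∃ c ∈ S, c ≠ a ∧ ¬ H.Adj a c) ∧
      ∀ b ∈ K, b ∈ S → b = a ∨ H.Adj a b := by
    by_cases h : ∃ a ∈ S, a ∈ K ∧ ∃ c ∈ S, c ≠ a ∧ ¬ H.Adj a c
    · obtain ⟨a, ha, haK, hc⟩ := h
      refine ⟨a, ha, hc, fun b hb _ => ?_⟩
      by_cases hab : b = a
      · exact Or.inl hab
      · exact Or.inr (hK haK hb (Ne.symm hab))
    · push Not at hcl h
      obtain ⟨a, ha, c, hc, hac, hnac⟩ := hcl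
      refine ⟨a, ha, ⟨c, hc, hac.symm, hnac⟩, fun b hb hbS => ?_⟩
      by_cases hab : a = b
      · exact Or.inl hab.symm
      · exact Or.inr (h b hbS hb a ha hab).symm
  obtain ⟨a, haS, ⟨c, hcS, hca, hnac⟩, hKa⟩ := hex
  set D : Set V := {v | v ∈ S ∧ v ≠ a ∧ ¬ H.Adj a v} with hD
  have hcD : c ∈ D := ⟨hcS, hca, hnac⟩
  set C : Finset V := S.filter fun v => v ∈ D ∧ (H.within D).Reachable c v with hC
  have hcC : c ∈ C := Finset.mem_filter.2 ⟨hcS, hcD, Reachable.refl _⟩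
  set Z : Finset V := S.filter fun z => z ∉ C ∧ ∃ d ∈ C, H.Adj z d with hZ
  have hCD : ∀ d ∈ C, d ∈ D := fun d hd => (Finset.mem_filter.1 hd).2.1
  have hstep : ∀ d ∈ C, ∀ v ∈ D, H.Adj d v → v ∈ C := by
    intro d hd v hv hdv
    refine Finset.mem_filter.2 ⟨hv.1, hv, (Finset.mem_filter.1 hd).2.2.trans ?_⟩
    exact Adj.reachable ⟨hdv, hCD d hd, hv⟩
  have hZa : ∀ z ∈ Z, H.Adj a z := by
    intro z hz
    obtain ⟨hzS, hzC, d, hd, hzd⟩ := Finset.mem_filter.1 hz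
    by_contra hn
    by_cases hza : z = a
    · subst hza; exact (hCD d hd).2.2 hzd
    · exact hzC (hstep d hd z ⟨hzS, hza, hn⟩ hzd.symm)
  have hZcl : (Z : Set V).Pairwise H.Adj := by
    intro z hz w hw hzw
    by_contra hn
    obtain ⟨_, _, d, hd, hzd⟩ := Finset.mem_filter.1 (Finset.mem_coe.1 hz)
    obtain ⟨_, _, e, he, hwe⟩ := Finset.mem_filter.1 (Finset.mem_coe.1 hw)
    refine not_isChordalGraph_of_reachable H a z w D (hZa z hz) (hZa w hw) hzw hn
      (fun c hc => hc.2) ?_ hH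
    have hle : H.within D ≤ H.within (D ∪ {z, w}) :=
      fun u v h => ⟨h.1, Or.inl h.2.1, Or.inl h.2.2⟩
    have h1 : (H.within (D ∪ {z, w})).Reachable z d :=
      Adj.reachable ⟨hzd, by simp, Or.inl (hCD d hd)⟩
    have h2 : (H.within (D ∪ {z, w})).Reachable e w :=
      Adj.reachable ⟨hwe.symm, Or.inl (hCD e he), by simp⟩
    have h3 : (H.within D).Reachable d e :=
      (Finset.mem_filter.1 hd).2.2.symm.trans (Finset.mem_filter.1 he).2.2
    exact (h1.trans (h3.mono hle)).trans h2
  have hsub : C ∪ Z ⊂ S := by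
    refine (Finset.ssubset_iff_of_subset ?_).2 ⟨a, haS, ?_⟩
    · exact Finset.union_subset (Finset.filter_subset _ _) (Finset.filter_subset _ _)
    · intro h
      rcases Finset.mem_union.1 h with h | h
      · exact (hCD a h).2.1 rfl
      · exact (hZa a h).ne rfl
  -- The boundary `Z` of the component `C` replaces `K`. The vertex found lies in `C`, so all its
  -- neighbours in `S` lie in `C ∪ Z`, and it avoids `K` because it is not adjacent to `a`.
  obtain ⟨v, hvZ, hv, hvs⟩ := ih (C ∪ Z) hsub Z hZcl
    ⟨c, Finset.mem_union_left _ hcC, fun h => (Finset.mem_filter.1 (Finset.mem_coe.1 h)).2.1 hcC⟩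
  have hvC : v ∈ C := (Finset.mem_union.1 hv).resolve_right hvZ
  have hnb : ∀ u ∈ S, H.Adj v u → u ∈ C ∪ Z := by
    intro u hu hvu
    by_cases h : u ∈ C
    · exact Finset.mem_union_left _ h
    · exact Finset.mem_union_right _ (Finset.mem_filter.2 ⟨hu, h, v, hvC, hvu.symm⟩)
  refine ⟨v, fun hvK => ?_, (hCD v hvC).1, fun x hx y hy hvx hvy =>
    hvs x (hnb x hx hvx) y (hnb y hy hvy) hvx hvy⟩
  rcases hKa v hvK (hCD v hvC).1 with h | h
  · exact (hCD v hvC).2.1 h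
  · exact (hCD v hvC).2.2 h

open Classical in
/-- A graph all of whose nonempty vertex sets have simplicial vertices is chordal. -/
theorem isChordalGraph_of_isSimplicialIn {H : SimpleGraph V}
    (h : ∀ S : Finset V, S.Nonempty → ∃ v, H.IsSimplicialIn S v) : IsChordalGraph H := by
  rintro k hk ⟨f⟩
  have : NeZero k := ⟨by omega⟩
  obtain ⟨v, hv, hs⟩ := h (Finset.univ.image f) ⟨f 0, Finset.mem_image_of_mem _ (Finset.mem_univ _)⟩
  obtain ⟨i, -, rfl⟩ := Finset.mem_image.1 hv
  obtain ⟨m, rfl⟩ : ∃ m, k = m + 4 := ⟨k - 4, by omega⟩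
  have h1 : (cycleGraph (m + 4)).Adj i (i + 1) := by
    rw [cycleGraph_adj]; right; abel
  have h2 : (cycleGraph (m + 4)).Adj i (i - 1) := by
    rw [cycleGraph_adj]; left; abel
  have e2 : ((1 : Fin (m + 4)) + 1).val = 2 := by
    rw [Fin.val_add, Fin.val_one]; exact Nat.mod_eq_of_lt (by omega)
  have e3 : ((1 : Fin (m + 4)) + 1 + 1).val = 3 := by
    rw [Fin.val_add, e2, Fin.val_one]; exact Nat.mod_eq_of_lt (by omega)
  have hne : i + 1 ≠ i - 1 := by
    intro he
    have : (1 : Fin (m + 4)) + 1 = 0 := by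
      have := congrArg (fun x => x - i + 1) he
      calc (1 : Fin (m + 4)) + 1 = i + 1 - i + 1 := by abel
        _ = i - 1 - i + 1 := this
        _ = 0 := by abel
    rw [this] at e2; simp at e2
  -- Both cycle neighbours of a simplicial vertex would be adjacent, so `2 = 1` or `3 = 0` modulo
  -- the length, which is at least four.
  have h3 := hs _ (Finset.mem_image_of_mem f (Finset.mem_univ (i + 1))) _
    (Finset.mem_image_of_mem f (Finset.mem_univ (i - 1))) (f.map_adj_iff.2 h1) (f.map_adj_iff.2 h2)
    (fun he => hne (f.injective he))
  rw [f.map_adj_iff, cycleGraph_adj] at h3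
  rcases h3 with h3 | h3
  · have : (1 : Fin (m + 4)) + 1 = 1 := 
      calc (1 : Fin (m + 4)) + 1 = i + 1 - (i - 1) := by abel
        _ = 1 := h3
    have := congrArg Fin.val this
    rw [e2, Fin.val_one] at this; omega
  · have : (1 : Fin (m + 4)) + 1 + 1 = 0 := by
      calc (1 : Fin (m + 4)) + 1 + 1 = 1 + 1 + (i - 1 - (i + 1)) := by rw [h3]
        _ = 0 := by abel
    rw [this] at e3; simp at e3

end SimpleGraph

/-! ### Flips and nested chordal graphs -/

namespace SimpleGraph

variable {V : Type*}

/-- Make the common neighbourhood of `x` and `y` complete, then delete the edge `xy`. -/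
def flip (H : SimpleGraph V) (x y : V) : SimpleGraph V where
  Adj u v := (H.Adj u v ∨ (u ≠ v ∧ (H.Adj x u ∧ H.Adj y u) ∧ (H.Adj x v ∧ H.Adj y v))) ∧
    ¬ (u = x ∧ v = y) ∧ ¬ (u = y ∧ v = x)
  symm := ⟨by
    rintro u v ⟨h, h1, h2⟩
    refine ⟨?_, fun h' => h2 h'.symm, fun h' => h1 h'.symm⟩
    rcases h with h | ⟨hne, h3, h4⟩
    · exact Or.inl h.symm
    · exact Or.inr ⟨hne.symm, h4, h3⟩⟩
  loopless := ⟨by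
    rintro u ⟨h | h, -⟩
    · exact H.loopless.irrefl _ h
    · exact h.1 rfl⟩

theorem flip_mono {H K : SimpleGraph V} (h : H ≤ K) (x y : V) : H.flip x y ≤ K.flip x y := by
  rintro u v ⟨h1, h2⟩
  refine ⟨?_, h2⟩
  rcases h1 with h1 | ⟨hne, h3, h4⟩
  · exact Or.inl (h h1)
  · exact Or.inr ⟨hne, ⟨h h3.1, h h3.2⟩, h h4.1, h h4.2⟩

theorem le_flip {G H : SimpleGraph V} (h : G ≤ H) {x y : V} (hxy : ¬ G.Adj x y) :
    G ≤ H.flip x y := by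
  refine fun u v huv => ⟨Or.inl (h huv), ?_, ?_⟩
  · rintro ⟨rfl, rfl⟩; exact hxy huv
  · rintro ⟨rfl, rfl⟩; exact hxy huv.symm

/-- The common neighbours of `x` and `y` are pairwise adjacent. -/
def CommonClique (H : SimpleGraph V) (x y : V) : Prop :=
  ∀ u v, (H.Adj x u ∧ H.Adj y u) → (H.Adj x v ∧ H.Adj y v) → u ≠ v → H.Adj u v

theorem CommonClique.flip_le {H : SimpleGraph V} {x y : V} (h : H.CommonClique x y) :
    H.flip x y ≤ H := by
  rintro u v ⟨h1 | ⟨hne, h3, h4⟩, -⟩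
  · exact h1
  · exact h u v h3 h4 hne

theorem not_flip_adj (H : SimpleGraph V) (x y : V) : ¬ (H.flip x y).Adj x y :=
  fun h => h.2.1 ⟨rfl, rfl⟩

theorem CommonClique.flip_lt {H : SimpleGraph V} {x y : V} (h : H.CommonClique x y)
    (hxy : H.Adj x y) : H.flip x y < H :=
  lt_of_le_of_ne h.flip_le fun he => by
    have := H.not_flip_adj x y
    rw [he] at this
    exact this hxy

open Classical in
/-- Outside the closed common neighbourhood of an edge there are simplicial vertices. -/
theorem IsChordalGraph.exists_isSimplicialIn_outside {H : SimpleGraph V} (hH : IsChordalGraph H)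
    {x y : V} (hxy : H.Adj x y) (S : Finset V)
    (hS : ∃ v ∈ S, v ≠ x ∧ v ≠ y ∧ ¬ (H.Adj x v ∧ H.Adj y v)) :
    ∃ v, v ≠ x ∧ v ≠ y ∧ ¬ (H.Adj x v ∧ H.Adj y v) ∧ H.IsSimplicialIn S v := by
  suffices key : ∀ S : Finset V, x ∈ S → y ∈ S →
      (∃ v ∈ S, v ≠ x ∧ v ≠ y ∧ ¬ (H.Adj x v ∧ H.Adj y v)) →
      ∃ v, v ≠ x ∧ v ≠ y ∧ ¬ (H.Adj x v ∧ H.Adj y v) ∧ H.IsSimplicialIn S v by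
    obtain ⟨v, hvS, h1, h2, h3⟩ := hS
    obtain ⟨w, h1, h2, h3, hw, hws⟩ := key (insert x (insert y S)) (by simp) (by simp)
      ⟨v, by simp [hvS], h1, h2, h3⟩
    refine ⟨w, h1, h2, h3, by simpa [h1, h2] using hw, fun a ha b hb => ?_⟩
    exact hws a (by simp [ha]) b (by simp [hb])
  clear hS S
  intro S
  induction S using Finset.strongInduction with
  | H S ih =>
  intro hx hy ⟨v, hvS, h1, h2, h3⟩
  have hcl : ({x, y} : Set V).Pairwise H.Adj := by
    rintro a (rfl | rfl) b (rfl | rfl) hab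
    · exact absurd rfl hab
    · exact hxy
    · exact hxy.symm
    · exact absurd rfl hab
  obtain ⟨w, hw, hwS, hws⟩ := IsChordalGraph.exists_isSimplicialIn hH S {x, y} hcl
    ⟨v, hvS, by simp [h1, h2]⟩
  simp only [Set.mem_insert_iff, Set.mem_singleton_iff, not_or] at hw
  -- A simplicial `w` in the common neighbourhood can be discarded: were the vertex `u` found in
  -- `S.erase w` adjacent to `w`, simpliciality of `w` would join `u` to both `x` and `y`.
  by_cases hwC : H.Adj x w ∧ H.Adj y w
  · have hvw : v ≠ w := by rintro rfl; exact h3 hwC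
    obtain ⟨u, hu1, hu2, hu3, hu, hus⟩ := ih (S.erase w) (Finset.erase_ssubset hwS)
      (Finset.mem_erase.2 ⟨Ne.symm hw.1, hx⟩) (Finset.mem_erase.2 ⟨Ne.symm hw.2, hy⟩)
      ⟨v, Finset.mem_erase.2 ⟨hvw, hvS⟩, h1, h2, h3⟩
    have huS := Finset.mem_of_mem_erase hu
    have huw : ¬ H.Adj u w := by
      intro h
      exact hu3 ⟨hws x hx u huS hwC.1.symm h.symm (Ne.symm hu1),
        hws y hy u huS hwC.2.symm h.symm (Ne.symm hu2)⟩
    refine ⟨u, hu1, hu2, hu3, huS, fun a ha b hb hua hub hab => ?_⟩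
    refine hus a (Finset.mem_erase.2 ⟨?_, ha⟩) b (Finset.mem_erase.2 ⟨?_, hb⟩) hua hub hab
    · rintro rfl; exact huw hua
    · rintro rfl; exact huw hub
  · exact ⟨w, hw.1, hw.2, hwC, hwS, hws⟩

/-- Flipping an edge preserves chordality. -/
theorem IsChordalGraph.flip {H : SimpleGraph V} (hH : IsChordalGraph H) {x y : V}
    (hxy : H.Adj x y) : IsChordalGraph (H.flip x y) := by
  refine isChordalGraph_of_isSimplicialIn fun S hS => ?_
  -- The flip adds no edge at a vertex outside the closed common neighbourhood, so a simplicial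
  -- vertex there stays simplicial. If `S` has no such vertex, `x` or `y` is simplicial when
  -- present, and otherwise `S` is complete after the flip.
  by_cases hout : ∃ v ∈ S, v ≠ x ∧ v ≠ y ∧ ¬ (H.Adj x v ∧ H.Adj y v)
  · obtain ⟨w, h1, h2, h3, hwS, hws⟩ :=
      IsChordalGraph.exists_isSimplicialIn_outside hH hxy S hout
    have hnb : ∀ u, (H.flip x y).Adj w u → H.Adj w u := by
      rintro u ⟨h | h, -⟩
      · exact h
      · exact absurd h.2.1 h3
    refine ⟨w, hwS, fun a ha b hb hwa hwb hab => ⟨Or.inl ?_, ?_, ?_⟩⟩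
    · exact hws a ha b hb (hnb a hwa) (hnb b hwb) hab
    · rintro ⟨rfl, rfl⟩; exact h3 ⟨(hnb _ hwa).symm, (hnb _ hwb).symm⟩
    · rintro ⟨rfl, rfl⟩; exact h3 ⟨(hnb _ hwb).symm, (hnb _ hwa).symm⟩
  push Not at hout
  have hin : ∀ z, (z = x ∨ z = y) → z ∈ S → (H.flip x y).IsSimplicialIn S z := by
    intro z hz hzS
    have hnb : ∀ u ∈ S, (H.flip x y).Adj z u → H.Adj x u ∧ H.Adj y u := by
      intro u hu hzu
      by_cases hux : u = x
      · subst hux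
        rcases hz with rfl | rfl
        · exact absurd rfl hzu.ne
        · exact absurd ⟨rfl, rfl⟩ hzu.2.2
      by_cases huy : u = y
      · subst huy
        rcases hz with rfl | rfl
        · exact absurd ⟨rfl, rfl⟩ hzu.2.1
        · exact absurd rfl hzu.ne
      exact hout u hu hux huy
    refine ⟨hzS, fun a ha b hb hza hzb hab => ⟨Or.inr ⟨hab, hnb a ha hza, hnb b hb hzb⟩, ?_, ?_⟩⟩
    · rintro ⟨rfl, rfl⟩; exact (hnb _ ha hza).1.ne rfl
    · rintro ⟨rfl, rfl⟩; exact (hnb _ ha hza).2.ne rfl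
  by_cases hx : x ∈ S
  · exact ⟨x, hin x (Or.inl rfl) hx⟩
  by_cases hy : y ∈ S
  · exact ⟨y, hin y (Or.inr rfl) hy⟩
  obtain ⟨v, hv⟩ := hS
  have hC : ∀ u ∈ S, H.Adj x u ∧ H.Adj y u := fun u hu =>
    hout u hu (fun h => hx (h ▸ hu)) (fun h => hy (h ▸ hu))
  refine ⟨v, hv, fun a ha b hb _ _ hab => ⟨Or.inr ⟨hab, hC a ha, hC b hb⟩, ?_, ?_⟩⟩
  · rintro ⟨rfl, rfl⟩; exact hx ha
  · rintro ⟨rfl, rfl⟩; exact hy ha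

open Classical in
/-- Between two nested chordal graphs there is an edge of the larger one whose common
neighbourhood is complete. -/
theorem exists_commonClique [Finite V] {G H : SimpleGraph V} (hG : IsChordalGraph G)
    (hH : IsChordalGraph H) (hlt : G < H) :
    ∃ x y, H.Adj x y ∧ ¬ G.Adj x y ∧ H.CommonClique x y := by
  have := Fintype.ofFinite V
  suffices key : ∀ S : Finset V, (∃ x ∈ S, ∃ y ∈ S, H.Adj x y ∧ ¬ G.Adj x y) →
      ∃ x ∈ S, ∃ y ∈ S, H.Adj x y ∧ ¬ G.Adj x y ∧
        ∀ u ∈ S, ∀ v ∈ S, (H.Adj x u ∧ H.Adj y u) → (H.Adj x v ∧ H.Adj y v) → u ≠ v → H.Adj u v by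
    obtain ⟨x, -, y, -, h1, h2, h3⟩ := key Finset.univ (by
      by_contra hc
      push Not at hc
      exact hlt.not_ge fun x y h => hc x (Finset.mem_univ _) y (Finset.mem_univ _) h)
    exact ⟨x, y, h1, h2, fun u v => h3 u (Finset.mem_univ _) v (Finset.mem_univ _)⟩
  have hle : ∀ {a b}, G.Adj a b → H.Adj a b := fun h => hlt.le h
  intro S
  induction S using Finset.strongInduction with
  | H S ih =>
  intro ⟨x, hx, y, hy, hxy, hnxy⟩
  obtain ⟨v, -, hvS, hvs⟩ := IsChordalGraph.exists_isSimplicialIn hG S ∅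
    (Set.pairwise_empty _) ⟨x, hx, by simp⟩
  -- If `v` gains a neighbour in `H`, its `G`-neighbours form a clique to be avoided inside its
  -- `H`-neighbours; a simplicial `w` there gives the edge `vw`. If not, `v` is dropped: common
  -- neighbours `p`, `q` of `v` would be adjacent in `G`.
  by_cases hv : ∃ u ∈ S, H.Adj v u ∧ ¬ G.Adj v u
  · obtain ⟨u, huS, hu⟩ := hv
    obtain ⟨w, hwK, hw, hws⟩ := IsChordalGraph.exists_isSimplicialIn hH
      (S.filter fun u => H.Adj v u) {u | u ∈ S ∧ G.Adj v u}
      (fun a ha b hb hab => hle (hvs a ha.1 b hb.1 ha.2 hb.2 hab))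
      ⟨u, Finset.mem_filter.2 ⟨huS, hu.1⟩, fun h => hu.2 h.2⟩
    obtain ⟨hwS, hvw⟩ := Finset.mem_filter.1 hw
    refine ⟨v, hvS, w, hwS, hvw, fun h => hwK ⟨hwS, h⟩, fun a ha b hb haa hbb hab => ?_⟩
    exact hws a (Finset.mem_filter.2 ⟨ha, haa.1⟩) b (Finset.mem_filter.2 ⟨hb, hbb.1⟩) haa.2 hbb.2 hab
  · push Not at hv
    have hvx : x ≠ v := by rintro rfl; exact hnxy (hv y hy hxy)
    have hvy : y ≠ v := by rintro rfl; exact hnxy (hv x hx hxy.symm).symm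
    obtain ⟨p, hp, q, hq, hpq, hnpq, hcl⟩ := ih (S.erase v) (Finset.erase_ssubset hvS)
      ⟨x, Finset.mem_erase.2 ⟨hvx, hx⟩, y, Finset.mem_erase.2 ⟨hvy, hy⟩, hxy, hnxy⟩
    have hpS := Finset.mem_of_mem_erase hp
    have hqS := Finset.mem_of_mem_erase hq
    have hnv : ¬ (H.Adj p v ∧ H.Adj q v) := fun h =>
      hnpq (hvs p hpS q hqS (hv p hpS h.1.symm) (hv q hqS h.2.symm) hpq.ne)
    refine ⟨p, hpS, q, hqS, hpq, hnpq, fun a ha b hb haa hbb hab => ?_⟩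
    refine hcl a (Finset.mem_erase.2 ⟨?_, ha⟩) b (Finset.mem_erase.2 ⟨?_, hb⟩) haa hbb hab
    · rintro rfl; exact hnv haa
    · rintro rfl; exact hnv hbb

/-- `H` is a minimal chordal graph above `G`. -/
def IsMinimalTriangulation (G H : SimpleGraph V) : Prop :=
  Minimal (fun K => G ≤ K ∧ IsChordalGraph K) H

/-- The fill edge `xy` can be deleted without losing chordality. -/
def Removable (G H : SimpleGraph V) (x y : V) : Prop :=
  H.Adj x y ∧ ¬ G.Adj x y ∧ H.CommonClique x y

open Classical in
/-- Delete `xy` if that is possible. -/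
noncomputable def tryRemove (G : SimpleGraph V) (x y : V) (H : SimpleGraph V) : SimpleGraph V :=
  if Removable G H x y then H.flip x y else H

theorem tryRemove_le (G : SimpleGraph V) (x y : V) (H : SimpleGraph V) :
    tryRemove G x y H ≤ H := by
  unfold tryRemove
  split_ifs with h
  · exact h.2.2.flip_le
  · exact le_rfl

theorem not_removable_of_tryRemove_eq {G : SimpleGraph V} {x y : V} {H : SimpleGraph V}
    (h : tryRemove G x y H = H) : ¬ Removable G H x y := by
  intro hr
  rw [tryRemove, if_pos hr] at h
  exact (hr.2.2.flip_lt hr.1).ne h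

theorem tryRemove_invariant {G : SimpleGraph V} {x y : V} {H : SimpleGraph V}
    (h : G ≤ H ∧ IsChordalGraph H) :
    G ≤ tryRemove G x y H ∧ IsChordalGraph (tryRemove G x y H) := by
  unfold tryRemove
  split_ifs with hr
  · exact ⟨le_flip h.1 hr.2.1, IsChordalGraph.flip h.2 hr.1⟩
  · exact h

end SimpleGraph

/-! ### Folds and iterates of decreasing maps -/

section Fold

variable {α ι : Type*}

theorem foldr_le_of_le [Preorder α] (f : ι → α → α) (hf : ∀ i a, f i a ≤ a) (l : List ι) (a : α) :
    l.foldr f a ≤ a := by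
  induction l with
  | nil => exact le_rfl
  | cons i l ih => exact (hf i _).trans ih

theorem foldr_invariant (f : ι → α → α) (P : α → Prop) (hf : ∀ i a, P a → P (f i a)) (l : List ι)
    (a : α) (ha : P a) : P (l.foldr f a) := by
  induction l with
  | nil => exact ha
  | cons i l ih => exact hf i _ ih

/-- Decreasing steps cannot undo one another, so a composite that returns its start has moved at no
step. -/
theorem forall_fixed_of_foldr_eq [PartialOrder α] (f : ι → α → α) (hf : ∀ i a, f i a ≤ a)
    (l : List ι) (a : α) (h : l.foldr f a = a) : ∀ i ∈ l, f i a = a := by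
  induction l with
  | nil => simp
  | cons i l ih =>
    have h1 : l.foldr f a = a :=
      le_antisymm (foldr_le_of_le f hf l a) (h.symm.le.trans (hf i _))
    rw [List.foldr_cons, h1] at h
    simpa [h] using ih h1

theorem iterate_fixed_of_lt (f : α → α) (μ : α → ℕ) (hf : ∀ a, f a = a ∨ μ (f a) < μ a) (m : ℕ)
    (a : α) (hm : μ a ≤ m) : f (f^[m] a) = f^[m] a := by
  induction m generalizing a with
  | zero => rcases hf a with h | h
            · exact h
            · omega
  | succ m ih =>
    rw [Function.iterate_succ_apply]
    rcases hf a with h | h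
    · have : ∀ k, f^[k] a = a := fun k => Function.iterate_fixed h k
      rw [h, this, h]
    · exact ih _ (by omega)

end Fold

/-! ### Greedy minimization and connectivity of the solution graph -/

namespace SimpleGraph

variable {n : ℕ}

/-- One attempt to delete each pair of vertices. -/
noncomputable def removePass (G H : SimpleGraph (Fin n)) : SimpleGraph (Fin n) :=
  (List.finRange n).foldr (fun x H => (List.finRange n).foldr (fun y H => tryRemove G x y H) H) H

/-- Delete fill edges as long as possible. -/
noncomputable def minimize (G H : SimpleGraph (Fin n)) : SimpleGraph (Fin n) :=
  (List.finRange n).foldr (fun _ H => (List.finRange n).foldr (fun _ H => removePass G H) H) H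

theorem removePass_le (G H : SimpleGraph (Fin n)) : removePass G H ≤ H :=
  foldr_le_of_le _ (fun x H => foldr_le_of_le _ (fun y H => tryRemove_le G x y H) _ H) _ H

theorem minimize_le (G H : SimpleGraph (Fin n)) : minimize G H ≤ H :=
  foldr_le_of_le _ (fun _ H => foldr_le_of_le _ (fun _ H => removePass_le G H) _ H) _ H

theorem minimize_invariant {G H : SimpleGraph (Fin n)} (h : G ≤ H ∧ IsChordalGraph H) :
    G ≤ minimize G H ∧ IsChordalGraph (minimize G H) := by
  refine foldr_invariant _ (fun H => G ≤ H ∧ IsChordalGraph H) (fun _ H h => ?_) _ H h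
  refine foldr_invariant _ (fun H => G ≤ H ∧ IsChordalGraph H) (fun _ H h => ?_) _ H h
  refine foldr_invariant _ (fun H => G ≤ H ∧ IsChordalGraph H) (fun _ H h => ?_) _ H h
  refine foldr_invariant _ (fun H => G ≤ H ∧ IsChordalGraph H) (fun _ H h => ?_) _ H h
  exact tryRemove_invariant h

theorem not_removable_of_removePass_eq {G H : SimpleGraph (Fin n)} (h : removePass G H = H)
    (x y : Fin n) : ¬ Removable G H x y := by
  have h1 := forall_fixed_of_foldr_eq _
    (fun x H => foldr_le_of_le _ (fun y H => tryRemove_le G x y H) _ H) _ H h x (List.mem_finRange x)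
  exact not_removable_of_tryRemove_eq
    (forall_fixed_of_foldr_eq _ (fun y H => tryRemove_le G x y H) _ H h1 y (List.mem_finRange y))

/-- The two outer folds ignore their indices and only count to `n * n`; the fold form is what
`Computes.fold` can implement. -/
theorem minimize_eq_iterate (G H : SimpleGraph (Fin n)) :
    minimize G H = (removePass G)^[n * n] H := by
  simp only [minimize, List.foldr_const, List.length_finRange]
  rw [← Function.iterate_mul]

theorem removePass_minimize (G H : SimpleGraph (Fin n)) :
    removePass G (minimize G H) = minimize G H := by
  rw [minimize_eq_iterate]
  -- Every pass that changes the graph loses an adjacent ordered pair, and there are at most `n * n`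
  -- of these.
  refine iterate_fixed_of_lt _ (fun H => {p : Fin n × Fin n | H.Adj p.1 p.2}.ncard) ?_ _ _ ?_
  · intro H
    by_cases h : removePass G H = H
    · exact Or.inl h
    · right
      refine Set.ncard_lt_ncard ?_ (Set.toFinite _)
      refine ⟨fun p hp => removePass_le G H hp, fun hc => h ?_⟩
      exact le_antisymm (removePass_le G H) fun x y hxy => hc (show (x, y) ∈ _ from hxy)
  · refine (Set.ncard_le_ncard (Set.subset_univ _) (Set.toFinite _)).trans ?_
    simp [Set.ncard_univ]

/-- A smaller chordal graph above `G` would yield, by `exists_commonClique`, a removable edge, which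
a fixed point of `removePass` does not have. -/
theorem isMinimalTriangulation_minimize {G H : SimpleGraph (Fin n)} (hGH : G ≤ H)
    (hH : IsChordalGraph H) : IsMinimalTriangulation G (minimize G H) := by
  obtain ⟨h1, h2⟩ := minimize_invariant ⟨hGH, hH⟩
  refine ⟨⟨h1, h2⟩, fun K hK hle => ?_⟩
  by_contra hn
  obtain ⟨x, y, hxy, hnxy, hc⟩ := exists_commonClique hK.2 h2 (lt_of_le_not_ge hle hn)
  exact not_removable_of_removePass_eq (removePass_minimize G H) x y
    ⟨hxy, fun h => hnxy (hK.1 h), hc⟩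

theorem isChordalGraph_top : IsChordalGraph (⊤ : SimpleGraph (Fin n)) :=
  isChordalGraph_of_isSimplicialIn fun _ ⟨v, hv⟩ => ⟨v, hv, fun _ _ _ _ _ _ hab => hab⟩

open Classical in
/-- The neighbour of `H` in the solution graph along the fill edge `xy`. -/
noncomputable def neighbor (G H : SimpleGraph (Fin n)) (x y : Fin n) : SimpleGraph (Fin n) :=
  minimize G (if H.Adj x y ∧ ¬ G.Adj x y then H.flip x y else H)

theorem isMinimalTriangulation_neighbor {G H : SimpleGraph (Fin n)}
    (h : IsMinimalTriangulation G H) (x y : Fin n) :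
    IsMinimalTriangulation G (neighbor G H x y) := by
  unfold neighbor
  split_ifs with hc
  · exact isMinimalTriangulation_minimize (le_flip h.1.1 hc.2) (IsChordalGraph.flip h.1.2 hc.1)
  · exact isMinimalTriangulation_minimize h.1.1 h.1.2

theorem isMinimalTriangulation_minimize_top (G : SimpleGraph (Fin n)) :
    IsMinimalTriangulation G (minimize G ⊤) :=
  isMinimalTriangulation_minimize le_top isChordalGraph_top

/-- The solution graph is connected: every minimal triangulation is reached. -/
theorem mem_of_neighbor_closed {G : SimpleGraph (Fin n)} (R : Set (SimpleGraph (Fin n)))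
    (hR : ∀ H ∈ R, IsMinimalTriangulation G H) (h0 : minimize G ⊤ ∈ R)
    (hcl : ∀ H ∈ R, ∀ x y, neighbor G H x y ∈ R) {T : SimpleGraph (Fin n)}
    (hT : IsMinimalTriangulation G T) : T ∈ R := by
  suffices key : ∀ K : SimpleGraph (Fin n), T ≤ K → IsChordalGraph K → (∃ H ∈ R, H ≤ K) → T ∈ R from
    key ⊤ le_top isChordalGraph_top ⟨_, h0, le_top⟩
  intro K
  induction K using WellFoundedLT.induction with
  | ind K ih =>
  intro hTK hK ⟨H, hHR, hHK⟩
  -- When `K = T`, minimality of `T` forces `H = T`. Otherwise an edge of `K` is deleted, and `H` is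
  -- replaced by a successor only if it contains that edge.
  rcases hTK.eq_or_lt with rfl | hlt
  · have := le_antisymm hHK (hT.2 (hR H hHR).1 hHK)
    exact this ▸ hHR
  · obtain ⟨x, y, hxy, hnxy, hc⟩ := exists_commonClique hT.1.2 hK hlt
    refine ih (K.flip x y) (hc.flip_lt hxy) (le_flip hTK hnxy) (IsChordalGraph.flip hK hxy) ?_
    by_cases hH : H.Adj x y
    · refine ⟨_, hcl H hHR x y, (minimize_le _ _).trans ?_⟩
      rw [if_pos ⟨hH, fun h => hnxy (hT.1.1 h)⟩]
      exact flip_mono hHK x y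
    · exact ⟨H, hHR, le_flip hHK hH⟩

/-- Minimal chordal completions are the fill edge sets of minimal triangulations. -/
theorem isMinimalChordalCompletion_iff {V : Type*} (G : SimpleGraph V) (F : Set (Sym2 V)) :
    IsMinimalChordalCompletion G F ↔ ∃ H, IsMinimalTriangulation G H ∧ F = (H \ G).edgeSet := by
  have hcomp : ∀ H : SimpleGraph V, G ≤ H → IsChordalGraph H →
      IsChordalCompletion G (H \ G).edgeSet := by
    intro H hGH hH
    refine ⟨?_, ?_⟩
    · exact edgeSet_mono fun u v h => ⟨h.1.ne, h.2⟩
    · rw [fromEdgeSet_edgeSet, sup_sdiff_cancel_right hGH]; exact hH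
  have hback : ∀ F : Set (Sym2 V), F ⊆ Gᶜ.edgeSet →
      F = ((G ⊔ fromEdgeSet F) \ G).edgeSet := by
    intro F hF
    have hd : Disjoint (fromEdgeSet F) G := by
      rw [← fromEdgeSet_edgeSet Gᶜ] at hF
      have : fromEdgeSet F ≤ Gᶜ := by
        conv_rhs => rw [← fromEdgeSet_edgeSet Gᶜ]
        exact fromEdgeSet_mono (by simpa using hF)
      exact (disjoint_compl_left (a := G)).mono_left this
    rw [sup_sdiff_left_self, hd.sdiff_eq_left, edgeSet_fromEdgeSet]
    refine (sdiff_eq_left.2 ?_).symm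
    rw [Set.disjoint_left]
    exact fun e he => Gᶜ.not_isDiag_of_mem_edgeSet (hF he)
  constructor
  · rintro ⟨⟨hF, hc⟩, hmin⟩
    refine ⟨G ⊔ fromEdgeSet F, ⟨⟨le_sup_left, hc⟩, fun K hK hle => ?_⟩, hback F hF⟩
    have h1 := hmin (hcomp K hK.1 hK.2) (by
      rw [hback F hF]
      exact edgeSet_mono (sdiff_le_sdiff_right hle))
    have h2 := fromEdgeSet_mono h1
    rw [fromEdgeSet_edgeSet] at h2
    exact sup_le hK.1 (h2.trans sdiff_le)
  · rintro ⟨H, hH, rfl⟩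
    refine ⟨hcomp H hH.1.1 hH.1.2, fun F hF hle => ?_⟩
    have h1 : G ⊔ fromEdgeSet F ≤ H := by
      refine sup_le hH.1.1 ?_
      have := fromEdgeSet_mono hle
      rw [fromEdgeSet_edgeSet] at this
      exact this.trans sdiff_le
    have h2 := hH.2 ⟨le_sup_left, hF.2⟩ h1
    rw [hback F hF.1]
    exact edgeSet_mono (sdiff_le_sdiff_right h2)

end SimpleGraph

/-! ### Combinators for polynomial-time programs -/

namespace TreeProg

open Data

/-- Uniformly in the address `k`, some program replaces `v j` in variable `k` by `w j` in time
polynomial in `N j`, without output and without changing the variables below `k`. -/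
def Computes {J : Type} (N : J → ℕ) (v w : J → Data) : Prop :=
  ∃ (c : ℕ → Cmd) (p : Polynomial ℕ), ∀ (j : J) (k : ℕ) (s : State), s.vars k = v j →
    ∃ s', Exec (c k) s s' ∧ s'.vars k = w j ∧ (∀ i < k, s'.vars i = s.vars i) ∧
      s'.time ≤ s.time + p.eval (N j) ∧ s'.out = s.out

namespace Computes

variable {J : Type} {N : J → ℕ} {v w u : J → Data}

theorem congr (h : Computes N v w) (hw : ∀ j, w j = u j) : Computes N v u := by
  rwa [← funext hw]

theorem congr_left (h : Computes N v w) (hv : ∀ j, v j = u j) : Computes N u w := by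
  rwa [← funext hv]

theorem reindex {I : Type} (h : Computes N v w) (f : I → J) :
    Computes (fun i => N (f i)) (fun i => v (f i)) (fun i => w (f i)) := by
  obtain ⟨c, p, h⟩ := h
  exact ⟨c, p, fun i => h (f i)⟩

theorem id : Computes N v v :=
  ⟨fun _ => Cmd.skip, 0, fun _ _ s hs => ⟨s, Exec.skip s, hs, fun _ _ => rfl, by simp, rfl⟩⟩

theorem comp (h : Computes N v w) (h' : Computes N w u) : Computes N v u := by
  obtain ⟨c, p, h⟩ := h
  obtain ⟨d, q, h'⟩ := h'
  refine ⟨fun k => Cmd.seq (c k) (d k), p + q, fun j k s hs => ?_⟩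
  obtain ⟨s1, e1, r1, l1, t1, o1⟩ := h j k s hs
  obtain ⟨s2, e2, r2, l2, t2, o2⟩ := h' j k s1 r1
  refine ⟨s2, Exec.seq e1 e2, r2, fun i hi => (l2 i hi).trans (l1 i hi), ?_, o2.trans o1⟩
  rw [Polynomial.eval_add]; omega

/-- The expression `e` serves only to fix a cost that does not depend on the address. -/
theorem of_expr (e : Expr) (f : Data → Data)
    (he : ∀ k, ∃ e' : Expr, e'.cost = e.cost ∧ ∀ σ : ℕ → Data, e'.eval σ = f (σ k)) :
    Computes N v (fun j => f (v j)) := by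
  choose e' hc hv using he
  refine ⟨fun k => Cmd.assign k (e' k), Polynomial.C (1 + e.cost), fun j k s hs =>
    ⟨_, Exec.assign _ _ _, ?_, fun i hi => ?_, ?_, rfl⟩⟩
  · simp [State.assign, State.value, hv, hs]
  · simp [State.assign, Function.update_of_ne hi.ne]
  · simp [State.assign, hc]

theorem nil : Computes N v (fun _ => Data.nil) :=
  of_expr Expr.nil (fun _ => Data.nil) fun _ => ⟨Expr.nil, rfl, fun _ => rfl⟩

theorem hd (h : Computes N v w) : Computes N v (fun j => (w j).hd) :=
  h.comp (of_expr (Expr.hd (Expr.var 0)) Data.hd fun k => ⟨Expr.hd (Expr.var k), rfl, fun _ => rfl⟩)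

theorem tl (h : Computes N v w) : Computes N v (fun j => (w j).tl) :=
  h.comp (of_expr (Expr.tl (Expr.var 0)) Data.tl fun k => ⟨Expr.tl (Expr.var k), rfl, fun _ => rfl⟩)

/-- Copying the argument to address `m` first lets the program run there, so everything stored below
`m` survives. -/
theorem call (h : Computes N v w) : ∃ (c : ℕ → ℕ → Cmd) (p : Polynomial ℕ),
    ∀ (j : J) (k m : ℕ) (s : State), s.vars k = v j →
      ∃ s', Exec (c k m) s s' ∧ s'.vars m = w j ∧ (∀ i < m, s'.vars i = s.vars i) ∧
        s'.time ≤ s.time + p.eval (N j) ∧ s'.out = s.out := by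
  obtain ⟨c, p, h⟩ := h
  refine ⟨fun k m => Cmd.seq (Cmd.assign m (Expr.var k)) (c m), p + 2, fun j k m s hs => ?_⟩
  obtain ⟨s', e, r, l, t, o⟩ := h j m (s.assign m (Expr.var k))
    (by simp [State.assign, State.value, Expr.eval, hs])
  refine ⟨s', Exec.seq (Exec.assign _ _ _) e, r, fun i hi => (l i hi).trans ?_, ?_, o⟩
  · simp [State.assign, Function.update_of_ne hi.ne]
  · simp only [State.assign, Expr.cost] at t
    simp only [Polynomial.eval_add, Polynomial.eval_ofNat]
    omega

theorem cons (h : Computes N v w) (h' : Computes N v u) :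
    Computes N v (fun j => Data.cons (w j) (u j)) := by
  obtain ⟨c, p, h⟩ := h.call
  obtain ⟨d, q, h'⟩ := h'.call
  refine ⟨fun k => Cmd.seq (c k (k + 1)) (Cmd.seq (d k (k + 2))
    (Cmd.assign k (Expr.cons (Expr.var (k + 1)) (Expr.var (k + 2))))), p + q + 4,
    fun j k s hs => ?_⟩
  obtain ⟨s1, e1, r1, l1, t1, o1⟩ := h j k (k + 1) s hs
  obtain ⟨s2, e2, r2, l2, t2, o2⟩ := h' j k (k + 2) s1 ((l1 k (by omega)).trans hs)
  refine ⟨_, Exec.seq e1 (Exec.seq e2 (Exec.assign _ _ _)), ?_, fun i hi => ?_, ?_, o2.trans o1⟩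
  · simp [State.assign, State.value, Expr.eval, r2, l2 (k + 1) (by omega), r1]
  · simp only [State.assign, Function.update_of_ne hi.ne]
    rw [l2 i (by omega), l1 i (by omega)]
  · simp only [State.assign, Expr.cost, Polynomial.eval_add, Polynomial.eval_ofNat]
    omega

open Classical in
theorem ite {b : J → Data} (hb : Computes N v b) (h : Computes N v w) (h' : Computes N v u) :
    Computes N v (fun j => if b j = Data.nil then u j else w j) := by
  obtain ⟨a, r, hb⟩ := hb.call
  obtain ⟨c, p, h⟩ := h
  obtain ⟨d, q, h'⟩ := h'
  refine ⟨fun k => Cmd.seq (a k (k + 1)) (Cmd.ite (Expr.var (k + 1)) (c k) (d k)),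
    r + p + q + 2, fun j k s hs => ?_⟩
  obtain ⟨s1, e1, r1, l1, t1, o1⟩ := hb j k (k + 1) s hs
  have hs1 : (s1.charge (Expr.var (k + 1))).vars k = v j := (l1 k (by omega)).trans hs
  have hv1 : s1.value (Expr.var (k + 1)) = b j := r1
  by_cases hbj : b j = Data.nil
  · obtain ⟨s2, e2, r2, l2, t2, o2⟩ := h' j k _ hs1
    refine ⟨s2, Exec.seq e1 (Exec.ite_false (hv1.trans hbj) e2), by simp [hbj, r2],
      fun i hi => (l2 i hi).trans (l1 i (by omega)), ?_, o2.trans o1⟩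
    simp only [State.charge, Expr.cost] at t2
    simp only [Polynomial.eval_add, Polynomial.eval_ofNat]
    omega
  · obtain ⟨s2, e2, r2, l2, t2, o2⟩ := h j k _ hs1
    refine ⟨s2, Exec.seq e1 (Exec.ite_true (by rwa [hv1]) e2), by simp [hbj, r2],
      fun i hi => (l2 i hi).trans (l1 i (by omega)), ?_, o2.trans o1⟩
    simp only [State.charge, Expr.cost] at t2
    simp only [Polynomial.eval_add, Polynomial.eval_ofNat]
    omega

/-- A loop running while the head of the state is not `nil`. -/
theorem loop (next : J → J) (rank : J → ℕ) (q : Polynomial ℕ) (hq : ∀ j, rank j ≤ q.eval (N j))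
    (hN : ∀ j, N (next j) = N j) (hrank : ∀ j, (w j).hd ≠ Data.nil → rank (next j) < rank j)
    (res : J → Data) (hdone : ∀ j, (w j).hd = Data.nil → res j = w j)
    (hres : ∀ j, (w j).hd ≠ Data.nil → res j = res (next j))
    (body : Computes (J := {j // (w j).hd ≠ Data.nil}) (fun j => N j.1) (fun j => w j.1)
      (fun j => w (next j.1))) :
    Computes N w res := by
  obtain ⟨c, p, h⟩ := body
  -- Each test costs 3 steps; the last summand pays for the final, failing test.
  refine ⟨fun k => Cmd.loop (Expr.hd (Expr.var k)) (c k), q * (p + 3) + 3, ?_⟩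
  suffices key : ∀ (r : ℕ) (j : J) (k : ℕ) (s : State), rank j ≤ r → s.vars k = w j →
      ∃ s', Exec (Cmd.loop (Expr.hd (Expr.var k)) (c k)) s s' ∧ s'.vars k = res j ∧
        (∀ i < k, s'.vars i = s.vars i) ∧
        s'.time ≤ s.time + (r * (p.eval (N j) + 3) + 3) ∧ s'.out = s.out by
    intro j k s hs
    obtain ⟨s', h1, h2, h3, h4, h5⟩ := key _ j k s (hq j) hs
    exact ⟨s', h1, h2, h3, by simpa using h4, h5⟩
  intro r
  induction r with
  | zero =>
    intro j k s hr hs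
    have hv : s.value (Expr.hd (Expr.var k)) = (w j).hd := by simp [State.value, Expr.eval, hs]
    have hnil : (w j).hd = Data.nil := by
      by_contra hc
      have := hrank j hc
      omega
    exact ⟨_, Exec.loop_stop (hv.trans hnil), by rw [hdone j hnil]; exact hs, fun _ _ => rfl,
      by simp only [State.charge, Expr.cost]; omega, rfl⟩
  | succ r ih =>
    intro j k s hr hs
    have hv : s.value (Expr.hd (Expr.var k)) = (w j).hd := by simp [State.value, Expr.eval, hs]
    by_cases hnil : (w j).hd = Data.nil
    · exact ⟨_, Exec.loop_stop (hv.trans hnil), by rw [hdone j hnil]; exact hs, fun _ _ => rfl,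
        by simp only [State.charge, Expr.cost]; omega, rfl⟩
    · obtain ⟨s1, e1, r1, l1, t1, o1⟩ := h ⟨j, hnil⟩ k (s.charge (Expr.hd (Expr.var k))) hs
      have := hrank j hnil
      obtain ⟨s2, e2, r2, l2, t2, o2⟩ := ih (next j) k s1 (by omega) r1
      refine ⟨s2, Exec.loop_step (by rwa [hv]) e1 e2, r2.trans (hres j hnil).symm,
        fun i hi => (l2 i hi).trans (l1 i hi), ?_, o2.trans o1⟩
      simp only [State.charge, Expr.cost] at t1
      rw [hN] at t2
      rw [Nat.succ_mul]
      omega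

end Computes

/-! ### Unary numbers, bits and lists -/

/-- Unary numbers. -/
def num : ℕ → Data
  | 0 => nil
  | a + 1 => cons nil (num a)

/-- Truth values as trees. -/
noncomputable def bit (P : Prop) : Data :=
  open Classical in ofBool (decide P)

@[simp] theorem bit_of_pos {P : Prop} (h : P) : bit P = cons nil nil := by simp [bit, h, ofBool]

@[simp] theorem bit_of_neg {P : Prop} (h : ¬ P) : bit P = nil := by simp [bit, h, ofBool]

theorem iterate_tl_nil (a : ℕ) : tl^[a] nil = nil := Function.iterate_fixed rfl a

theorem iterate_tl_num (a b : ℕ) : tl^[a] (num b) = num (b - a) := by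
  induction a generalizing b with
  | zero => rfl
  | succ a ih =>
    cases b with
    | zero => simp [num, iterate_tl_nil]
    | succ b => rw [Function.iterate_succ_apply, num, tl, ih]; congr 1; omega

theorem num_eq_nil {a : ℕ} : num a = nil ↔ a = 0 := by cases a <;> simp [num]

theorem hd_iterate_tl_ofList (l : List Data) (a : ℕ) (h : a < l.length) :
    (tl^[a] (ofList l)).hd = l[a] := by
  induction l generalizing a with
  | nil => simp at h
  | cons x l ih =>
    cases a with
    | zero => rfl
    | succ a => rw [Function.iterate_succ_apply]; simpa [ofList, tl] using ih a (by simpa using h)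

namespace Computes

variable {J : Type} {N : J → ℕ} {v w u : J → Data} {P Q : J → Prop}

/-- The loop state pairs the counter with the data, so its head is the loop test. The bound on the
counter is built into the index type because `loop` needs it at every index. -/
theorem iterate_tl {a : J → ℕ} (q : Polynomial ℕ) (hq : ∀ j, a j ≤ q.eval (N j))
    (ha : Computes N v (fun j => num (a j))) (hw : Computes N v w) :
    Computes N v (fun j => Data.tl^[a j] (w j)) := by
  have key : Computes (J := {x : ℕ × ℕ × Data // x.2.1 ≤ q.eval x.1}) (fun x => x.1.1)
      (fun x => Data.cons (num x.1.2.1) x.1.2.2)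
      (fun x => Data.cons Data.nil (Data.tl^[x.1.2.1] x.1.2.2)) := by
    refine loop (fun x => ⟨(x.1.1, x.1.2.1 - 1, x.1.2.2.tl), (Nat.sub_le _ _).trans x.2⟩)
      (fun x => x.1.2.1) q (fun x => x.2) (fun _ => rfl) ?_ _ ?_ ?_ ?_
    · rintro ⟨⟨n, a, d⟩, h⟩ h'
      have : a ≠ 0 := fun h0 => h' (num_eq_nil.2 h0)
      simp only
      omega
    · rintro ⟨⟨n, a, d⟩, h⟩ h'
      obtain rfl : a = 0 := num_eq_nil.1 h'
      rfl
    · rintro ⟨⟨n, a, d⟩, h⟩ h'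
      cases a with
      | zero => exact absurd rfl h'
      | succ a => rfl
    · refine (id.hd.tl.cons id.tl.tl).congr ?_
      rintro ⟨⟨⟨n, a, d⟩, h⟩, h'⟩
      cases a with
      | zero => exact absurd rfl h'
      | succ a => rfl
  exact ((ha.cons hw).comp (key.reindex fun j => ⟨(N j, a j, w j), hq j⟩)).tl

theorem num_length {l : J → List Data} (q : Polynomial ℕ) (hq : ∀ j, (l j).length ≤ q.eval (N j))
    (hl : Computes N v (fun j => ofList (l j))) : Computes N v (fun j => num (l j).length) := by
  have key : Computes (J := {x : ℕ × List Data × ℕ // x.2.1.length ≤ q.eval x.1}) (fun x => x.1.1)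
      (fun x => Data.cons (ofList x.1.2.1) (num x.1.2.2))
      (fun x => Data.cons Data.nil (num (x.1.2.1.length + x.1.2.2))) := by
    refine loop (fun x => ⟨(x.1.1, x.1.2.1.tail, x.1.2.2 + 1),
        (by simp : x.1.2.1.tail.length ≤ x.1.2.1.length).trans x.2⟩)
      (fun x => x.1.2.1.length) q (fun x => x.2) (fun _ => rfl) ?_ _ ?_ ?_ ?_
    · rintro ⟨⟨n, l, d⟩, h⟩ h'
      cases l with
      | nil => exact absurd rfl h'
      | cons a l => simp
    · rintro ⟨⟨n, l, d⟩, h⟩ h'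
      cases l with
      | nil => simp [ofList]
      | cons a l => simp [ofList, Data.hd] at h'
    · rintro ⟨⟨n, l, d⟩, h⟩ h'
      cases l with
      | nil => exact absurd rfl h'
      | cons a l => simp [Nat.add_assoc, Nat.add_comm 1 d]
    · refine (id.hd.tl.cons (nil.cons id.tl)).congr ?_
      rintro ⟨⟨⟨n, l, d⟩, h⟩, h'⟩
      cases l with
      | nil => exact absurd rfl h'
      | cons a l => rfl
  exact ((hl.cons nil).comp (key.reindex fun j => ⟨(N j, l j, 0), hq j⟩)).tl

theorem true_ : Computes N v (fun _ => bit True) :=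
  (nil.cons nil).congr fun _ => by simp

theorem not_ (hP : Computes N v (fun j => bit (P j))) : Computes N v (fun j => bit (¬ P j)) :=
  (hP.ite nil true_).congr fun j => by by_cases h : P j <;> simp [h]

theorem and_ (hP : Computes N v (fun j => bit (P j))) (hQ : Computes N v (fun j => bit (Q j))) :
    Computes N v (fun j => bit (P j ∧ Q j)) :=
  (hP.ite hQ nil).congr fun j => by by_cases h : P j <;> simp [h]

theorem or_ (hP : Computes N v (fun j => bit (P j))) (hQ : Computes N v (fun j => bit (Q j))) :
    Computes N v (fun j => bit (P j ∨ Q j)) :=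
  (hP.ite true_ hQ).congr fun j => by by_cases h : P j <;> simp [h]

theorem bit_congr (hP : Computes N v (fun j => bit (P j))) (h : ∀ j, P j ↔ Q j) :
    Computes N v (fun j => bit (Q j)) :=
  hP.congr fun j => by rw [propext (h j)]

/-- Iterated tails give truncated subtraction, and two numbers are equal when both truncated
differences vanish. -/
theorem eq_fin {a b : ∀ j, Fin (N j)} (ha : Computes N v (fun j => num (a j)))
    (hb : Computes N v (fun j => num (b j))) : Computes N v (fun j => bit (a j = b j)) := by
  have h1 := iterate_tl Polynomial.X (fun j => by simp) ha hb
  have h2 := iterate_tl Polynomial.X (fun j => by simp) hb ha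
  refine (h1.ite nil (h2.ite nil true_)).congr fun j => ?_
  simp only [iterate_tl_num, num_eq_nil]
  by_cases h : a j = b j
  · simp [h]
  · have : (a j : ℕ) ≠ b j := fun h' => h (Fin.ext h')
    rw [bit_of_neg h]
    split_ifs <;> first | rfl | omega

/-- The state holds a counter, the accumulator and the unchanged input `v`. The counter runs
downwards because `foldr` treats the last index first. -/
theorem fold {β : J → Type} (enc : ∀ j, β j → Data) (step : ∀ j, Fin (N j) → β j → β j)
    (b : ∀ j, β j) (hn : Computes N v (fun j => num (N j)))
    (hb : Computes N v (fun j => enc j (b j)))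
    (hstep : Computes (J := Σ j, Fin (N j) × β j) (fun x => N x.1)
      (fun x => Data.cons (num x.2.1) (Data.cons (enc x.1 x.2.2) (v x.1)))
      (fun x => enc x.1 (step x.1 x.2.1 x.2.2))) :
    Computes N v (fun j => enc j ((List.finRange (N j)).foldr (step j) (b j))) := by
  have key : Computes (J := Σ j, {i // i ≤ N j} × β j) (fun x => N x.1)
      (fun x => Data.cons (num x.2.1) (Data.cons (enc x.1 x.2.2) (v x.1)))
      (fun x => Data.cons Data.nil (Data.cons (enc x.1
        (((List.finRange (N x.1)).take x.2.1).foldr (step x.1) x.2.2)) (v x.1))) := by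
    -- The `else` branch only makes the function total: a nonzero counter has its predecessor below
    -- `N`.
    refine loop (fun x => ⟨x.1, ⟨x.2.1.1 - 1, (Nat.sub_le _ _).trans x.2.1.2⟩,
      if h : x.2.1.1 - 1 < N x.1 then step x.1 ⟨x.2.1.1 - 1, h⟩ x.2.2 else x.2.2⟩)
      (fun x => x.2.1.1) Polynomial.X (fun x => by simpa using x.2.1.2) (fun _ => rfl) ?_ _ ?_ ?_ ?_
    · rintro ⟨j, ⟨i, hi⟩, b⟩ h'
      have : i ≠ 0 := fun h0 => h' (num_eq_nil.2 h0)
      simp only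
      omega
    · rintro ⟨j, ⟨i, hi⟩, b⟩ h'
      obtain rfl : i = 0 := num_eq_nil.1 h'
      simp [num]
    · rintro ⟨j, ⟨i, hi⟩, b⟩ h'
      cases i with
      | zero => exact absurd rfl h'
      | succ i =>
        have hi' : i < N j := hi
        simp only [Nat.add_sub_cancel, hi', dif_pos]
        rw [List.take_add_one, List.getElem?_eq_getElem (by simpa using hi')]
        simp
    · have hpos : ∀ x : {x : Σ j, {i // i ≤ N j} × β j // num x.2.1 ≠ Data.nil},
          x.1.2.1.1 - 1 < N x.1.1 := fun x => by
        have h1 := x.1.2.1.2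
        have h2 : x.1.2.1.1 ≠ 0 := fun h0 => x.2 (num_eq_nil.2 h0)
        omega
      have hs := (hstep.reindex fun x => ⟨x.1.1, ⟨_, hpos x⟩, x.1.2.2⟩).congr_left
        (u := fun x => Data.cons (num x.1.2.1).tl (Data.cons (enc x.1.1 x.1.2.2) (v x.1.1))) (by
          rintro ⟨⟨j, ⟨i, hi⟩, b⟩, h'⟩
          cases i with
          | zero => exact absurd rfl h'
          | succ i => rfl)
      have hs' := comp (v := fun x : {x : Σ j, {i // i ≤ N j} × β j // num x.2.1 ≠ Data.nil} =>
        Data.cons (num x.1.2.1) (Data.cons (enc x.1.1 x.1.2.2) (v x.1.1))) (id.hd.tl.cons id.tl) hs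
      refine (id.hd.tl.cons (Computes.cons hs' id.tl.tl)).congr ?_
      rintro ⟨⟨j, ⟨i, hi⟩, b⟩, h'⟩
      cases i with
      | zero => exact absurd rfl h'
      | succ i =>
        have hi' : i < N j := hi
        simp [hi', num, Data.hd, Data.tl]
  refine ((hn.cons (hb.cons id)).comp (key.reindex fun j => ⟨j, ⟨N j, le_rfl⟩, b j⟩)).tl.hd.congr
    fun j => ?_
  simp only [Data.tl, Data.hd]
  rw [List.take_of_length_le (by simp)]

theorem forall_ {P : ∀ j, Fin (N j) → Prop} (hn : Computes N v (fun j => num (N j)))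
    (hP : Computes (J := Σ j, Fin (N j)) (fun x => N x.1) (fun x => Data.cons (num x.2) (v x.1))
      (fun x => bit (P x.1 x.2))) : Computes N v (fun j => bit (∀ i, P j i)) := by
  have := fold (β := fun _ => Prop) (fun _ => bit) (fun j i b => P j i ∧ b) (fun _ => True) hn true_
    (((id.hd.cons id.tl.tl).comp (hP.reindex fun x : Σ j, Fin (N j) × Prop => ⟨x.1, x.2.1⟩)).and_
      id.tl.hd)
  refine this.bit_congr fun j => ?_
  have : ∀ l : List (Fin (N j)), l.foldr (fun i b => P j i ∧ b) True ↔ ∀ i ∈ l, P j i := by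
    intro l
    induction l with
    | nil => simp
    | cons a l ih => simp [ih]
  simp [this]

theorem tabulate {f : ∀ j, Fin (N j) → Data} (hn : Computes N v (fun j => num (N j)))
    (hf : Computes (J := Σ j, Fin (N j)) (fun x => N x.1) (fun x => Data.cons (num x.2) (v x.1))
      (fun x => f x.1 x.2)) : Computes N v (fun j => ofList (List.ofFn (f j))) := by
  have := fold (β := fun _ => List Data) (fun _ => ofList) (fun j i b => f j i :: b) (fun _ => [])
    hn nil
    (((id.hd.cons id.tl.tl).comp
      (hf.reindex fun x : Σ j, Fin (N j) × List Data => ⟨x.1, x.2.1⟩)).cons id.tl.hd)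
  refine this.congr fun j => ?_
  congr 1
  rw [List.ofFn_eq_map]
  induction List.finRange (N j) with
  | nil => rfl
  | cons a l ih => simp [ih]

theorem lookup {H : ∀ j, SimpleGraph (Fin (N j))} {a b : ∀ j, Fin (N j)}
    (hH : Computes N v (fun j => encodeGraph (H j)))
    (ha : Computes N v (fun j => num (a j))) (hb : Computes N v (fun j => num (b j))) :
    Computes N v (fun j => bit ((H j).Adj (a j) (b j))) := by
  have h1 := (iterate_tl Polynomial.X (fun j => by simp) ha hH).hd
  have h2 := (iterate_tl Polynomial.X (fun j => by simp) hb h1).hd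
  refine h2.congr fun j => ?_
  rw [encodeGraph, hd_iterate_tl_ofList _ _ (by simp), List.getElem_ofFn,
    hd_iterate_tl_ofList _ _ (by simp), List.getElem_ofFn]
  rfl

/-- Two nested tabulations put the column index in front of the row index, hence `id.hd` for columns
and `id.tl.hd` for rows in later uses. -/
theorem graph {H : ∀ j, SimpleGraph (Fin (N j))} (hn : Computes N v (fun j => num (N j)))
    (h : Computes (J := Σ x : (Σ j, Fin (N j)), Fin (N x.1)) (fun x => N x.1.1)
      (fun x => Data.cons (num x.2) (Data.cons (num x.1.2) (v x.1.1)))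
      (fun x => bit ((H x.1.1).Adj x.1.2 x.2))) :
    Computes N v (fun j => encodeGraph (H j)) :=
  tabulate hn (tabulate (J := Σ j, Fin (N j)) (comp id.tl (hn.reindex Sigma.fst)) h)

end Computes
end TreeProg

namespace TreeProg

open Data SimpleGraph

/-! ### Tries -/

/-- The node of a trie at a key. -/
def trieGet : List Bool → Data → Data
  | [], t => t
  | b :: k, t => trieGet k (if b then t.hd else t.tl)

/-- Mark a key in a trie. -/
def trieInsert : List Bool → Data → Data
  | [], _ => cons nil nil
  | b :: k, t => if b then cons (trieInsert k t.hd) t.tl else cons t.hd (trieInsert k t.tl)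

/-- The siblings along the path to a key, in front of `st`. -/
def triePath : List Bool → Data → List (Bool × Data) → List (Bool × Data)
  | [], _, st => st
  | b :: k, t, st => triePath k (if b then t.hd else t.tl) ((b, if b then t.tl else t.hd) :: st)

/-- Rebuild a trie along a path. -/
def triePlug : List (Bool × Data) → Data → Data
  | [], t => t
  | (b, d) :: st, t => triePlug st (if b then cons t d else cons d t)

theorem trieGet_nil (k : List Bool) : trieGet k nil = nil := by
  induction k with
  | nil => rfl
  | cons b k ih => cases b <;> simpa [trieGet, hd, tl] using ih

/-- Equal lengths are essential: a proper prefix of an inserted key also leads to a cell, and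
inserting a shorter key overwrites the subtree below it. -/
theorem trieGet_trieInsert (k k' : List Bool) (t : Data) (h : k.length = k'.length) :
    trieGet k (trieInsert k' t) ≠ nil ↔ k = k' ∨ trieGet k t ≠ nil := by
  induction k generalizing k' t with
  | nil => cases k' with
    | nil => simp [trieGet, trieInsert]
    | cons b k' => simp at h
  | cons a k ih => cases k' with
    | nil => simp at h
    | cons b k' =>
      have h' : k.length = k'.length := by simpa using h
      cases a <;> cases b <;> simp [trieGet, trieInsert, hd, tl, ih _ _ h']

/-- A zipper: recursive insertion becomes one loop down the trie and one loop back up. -/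
theorem triePlug_triePath (k : List Bool) (t : Data) (st : List (Bool × Data)) :
    triePlug (triePath k t st) (cons nil nil) = triePlug st (trieInsert k t) := by
  induction k generalizing t st with
  | nil => rfl
  | cons b k ih => cases b <;> simp [triePath, ih, triePlug, trieInsert]

theorem length_triePath (k : List Bool) (t : Data) (st : List (Bool × Data)) :
    (triePath k t st).length = k.length + st.length := by
  induction k generalizing t st with
  | nil => simp [triePath]
  | cons b k ih => simp [triePath, ih]; omega

/-- Bit lists as trees. -/
def encodeBits (k : List Bool) : Data := ofList (k.map ofBool)

/-- Trie paths as trees. -/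
def encodePath (st : List (Bool × Data)) : Data :=
  ofList (st.map fun x => cons (ofBool x.1) x.2)

namespace Computes

variable {J : Type} {N : J → ℕ} {v w u : J → Data} {P Q : J → Prop}

theorem triePath_get {k : J → List Bool} (q : Polynomial ℕ) (hq : ∀ j, (k j).length ≤ q.eval (N j))
    (hk : Computes N v (fun j => encodeBits (k j))) (hw : Computes N v w) :
    Computes N v (fun j => Data.cons (encodePath (triePath (k j) (w j) [])) (trieGet (k j) (w j))) := by
  have key : Computes
      (J := {x : ℕ × List Bool × Data × List (Bool × Data) // x.2.1.length ≤ q.eval x.1})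
      (fun x => x.1.1)
      (fun x => Data.cons (encodeBits x.1.2.1) (Data.cons (encodePath x.1.2.2.2) x.1.2.2.1))
      (fun x => Data.cons Data.nil (Data.cons (encodePath (triePath x.1.2.1 x.1.2.2.1 x.1.2.2.2))
        (trieGet x.1.2.1 x.1.2.2.1))) := by
    refine loop (fun x => ⟨(x.1.1, x.1.2.1.tail,
        if x.1.2.1.headI then x.1.2.2.1.hd else x.1.2.2.1.tl,
        (x.1.2.1.headI, if x.1.2.1.headI then x.1.2.2.1.tl else x.1.2.2.1.hd) :: x.1.2.2.2),
        (by simp : x.1.2.1.tail.length ≤ x.1.2.1.length).trans x.2⟩)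
      (fun x => x.1.2.1.length) q (fun x => x.2) (fun _ => rfl) ?_ _ ?_ ?_ ?_
    · rintro ⟨⟨n, k, t, st⟩, h⟩ h'
      cases k with
      | nil => exact absurd rfl h'
      | cons b k => simp
    · rintro ⟨⟨n, k, t, st⟩, h⟩ h'
      cases k with
      | nil => rfl
      | cons b k => simp [encodeBits, ofList, Data.hd] at h'
    · rintro ⟨⟨n, k, t, st⟩, h⟩ h'
      cases k with
      | nil => exact absurd rfl h'
      | cons b k => cases b <;> rfl
    · refine (id.hd.tl.cons (ite (b := fun x => (encodeBits x.1.1.2.1).hd)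
        id.hd.hd
        (((id.hd.hd.cons id.tl.tl.tl).cons id.tl.hd).cons id.tl.tl.hd)
        (((id.hd.hd.cons id.tl.tl.hd).cons id.tl.hd).cons id.tl.tl.tl))).congr ?_
      rintro ⟨⟨⟨n, k, t, st⟩, h⟩, h'⟩
      cases k with
      | nil => exact absurd rfl h'
      | cons b k => cases b <;> simp [encodeBits, encodePath, ofList, ofBool, Data.hd, Data.tl]
  exact ((hk.cons (nil.cons hw)).comp (key.reindex fun j => ⟨(N j, k j, w j, []), hq j⟩)).tl

open Classical in
theorem triePlug_ {st : J → List (Bool × Data)} (q : Polynomial ℕ)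
    (hq : ∀ j, (st j).length ≤ q.eval (N j))
    (hst : Computes N v (fun j => encodePath (st j))) (hw : Computes N v w) :
    Computes N v (fun j => triePlug (st j) (w j)) := by
  have key : Computes
      (J := {x : ℕ × List (Bool × Data) × Data // x.2.1.length ≤ q.eval x.1})
      (fun x => x.1.1)
      (fun x => Data.cons (encodePath x.1.2.1) x.1.2.2)
      (fun x => Data.cons Data.nil (triePlug x.1.2.1 x.1.2.2)) := by
    refine loop (fun x => ⟨(x.1.1, x.1.2.1.tail, if (encodePath x.1.2.1).hd.hd = Data.nil
          then Data.cons (encodePath x.1.2.1).hd.tl x.1.2.2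
          else Data.cons x.1.2.2 (encodePath x.1.2.1).hd.tl),
        (by simp : x.1.2.1.tail.length ≤ x.1.2.1.length).trans x.2⟩)
      (fun x => x.1.2.1.length) q (fun x => x.2) (fun _ => rfl) ?_ _ ?_ ?_ ?_
    · rintro ⟨⟨n, st, t⟩, h⟩ h'
      cases st with
      | nil => exact absurd rfl h'
      | cons b k => simp
    · rintro ⟨⟨n, st, t⟩, h⟩ h'
      cases st with
      | nil => rfl
      | cons b k => simp [encodePath, ofList, Data.hd] at h'
    · rintro ⟨⟨n, st, t⟩, h⟩ h'
      cases st with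
      | nil => exact absurd rfl h'
      | cons b k =>
        obtain ⟨b, d⟩ := b
        cases b <;> simp [encodePath, ofList, ofBool, Data.hd, Data.tl, triePlug]
    · refine (id.hd.tl.cons (ite (b := fun x => (encodePath x.1.1.2.1).hd.hd)
        id.hd.hd.hd (id.tl.cons id.hd.hd.tl) (id.hd.hd.tl.cons id.tl))).congr ?_
      rintro ⟨⟨⟨n, st, t⟩, h⟩, h'⟩
      cases st with
      | nil => exact absurd rfl h'
      | cons b k =>
        obtain ⟨b, d⟩ := b
        cases b <;> simp [encodePath, ofList, ofBool, Data.hd, Data.tl]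
  exact ((hst.cons hw).comp (key.reindex fun j => ⟨(N j, st j, w j), hq j⟩)).tl

theorem trieGet_ {k : J → List Bool} (q : Polynomial ℕ) (hq : ∀ j, (k j).length ≤ q.eval (N j))
    (hk : Computes N v (fun j => encodeBits (k j))) (hw : Computes N v w) :
    Computes N v (fun j => trieGet (k j) (w j)) :=
  (triePath_get q hq hk hw).tl

theorem trieInsert_ {k : J → List Bool} (q : Polynomial ℕ)
    (hq : ∀ j, (k j).length ≤ q.eval (N j))
    (hk : Computes N v (fun j => encodeBits (k j))) (hw : Computes N v w) :
    Computes N v (fun j => trieInsert (k j) (w j)) :=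
  (triePlug_ q (fun j => by simpa [length_triePath] using hq j) (triePath_get q hq hk hw).hd
    (nil.cons nil)).congr fun j => by rw [triePlug_triePath]; rfl

/-! ### Graph operations -/

/-- Weakening: what is computable from the input stays computable once a bound index is placed in
front of it. -/
theorem lift (h : Computes N v w) : Computes (J := Σ j, Fin (N j)) (fun x => N x.1)
    (fun x => Data.cons (num x.2) (v x.1)) (fun x => w x.1) :=
  comp id.tl (h.reindex Sigma.fst)

theorem liftFold {β : J → Type} (enc : ∀ j, β j → Data) (h : Computes N v w) :
    Computes (J := Σ j, Fin (N j) × β j) (fun x => N x.1)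
      (fun x => Data.cons (num x.2.1) (Data.cons (enc x.1 x.2.2) (v x.1))) (fun x => w x.1) :=
  comp id.tl.tl (h.reindex Sigma.fst)

variable {G H : ∀ j, SimpleGraph (Fin (N j))} {x y : ∀ j, Fin (N j)}

theorem liftGraph (h : Computes N v w) :
    Computes (J := Σ j, Fin (N j) × SimpleGraph (Fin (N j))) (fun x => N x.1)
      (fun x => Data.cons (num x.2.1) (Data.cons (encodeGraph x.2.2) (v x.1))) (fun x => w x.1) :=
  h.liftFold fun _ => encodeGraph

theorem common (hH : Computes N v (fun j => encodeGraph (H j)))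
    (hx : Computes N v (fun j => num (x j))) (hy : Computes N v (fun j => num (y j)))
    {a : ∀ j, Fin (N j)} (ha : Computes N v (fun j => num (a j))) :
    Computes N v (fun j => bit ((H j).Adj (x j) (a j) ∧ (H j).Adj (y j) (a j))) :=
  (lookup hH hx ha).and_ (lookup hH hy ha)

theorem flip (hn : Computes N v (fun j => num (N j)))
    (hH : Computes N v (fun j => encodeGraph (H j)))
    (hx : Computes N v (fun j => num (x j))) (hy : Computes N v (fun j => num (y j))) :
    Computes N v (fun j => encodeGraph ((H j).flip (x j) (y j))) := by
  refine graph hn ?_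
  have hH' := hH.lift.lift
  have hx' := hx.lift.lift
  have hy' := hy.lift.lift
  have hu := (id (N := fun x : Σ x : (Σ j, Fin (N j)), Fin (N x.1) => N x.1.1)
    (v := fun x => Data.cons (num x.2) (Data.cons (num x.1.2) (v x.1.1)))).tl.hd
  have hv := (id (N := fun x : Σ x : (Σ j, Fin (N j)), Fin (N x.1) => N x.1.1)
    (v := fun x => Data.cons (num x.2) (Data.cons (num x.1.2) (v x.1.1)))).hd
  exact ((lookup hH' hu hv).or_ ((eq_fin hu hv).not_.and_
    ((common hH' hx' hy' hu).and_ (common hH' hx' hy' hv)))).and_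
    (((eq_fin hu hx').and_ (eq_fin hv hy')).not_.and_ ((eq_fin hu hy').and_ (eq_fin hv hx')).not_)

theorem commonClique (hn : Computes N v (fun j => num (N j)))
    (hH : Computes N v (fun j => encodeGraph (H j)))
    (hx : Computes N v (fun j => num (x j))) (hy : Computes N v (fun j => num (y j))) :
    Computes N v (fun j => bit ((H j).CommonClique (x j) (y j))) := by
  have hH' := hH.lift.lift
  have hx' := hx.lift.lift
  have hy' := hy.lift.lift
  have hu := (id (N := fun x : Σ x : (Σ j, Fin (N j)), Fin (N x.1) => N x.1.1)
    (v := fun x => Data.cons (num x.2) (Data.cons (num x.1.2) (v x.1.1)))).tl.hd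
  have hv := (id (N := fun x : Σ x : (Σ j, Fin (N j)), Fin (N x.1) => N x.1.1)
    (v := fun x => Data.cons (num x.2) (Data.cons (num x.1.2) (v x.1.1)))).hd
  refine (forall_ (P := fun j a => ∀ b, ¬ (((H j).Adj (x j) a ∧ (H j).Adj (y j) a) ∧
      ((H j).Adj (x j) b ∧ (H j).Adj (y j) b) ∧ ¬ a = b) ∨ (H j).Adj a b) hn
    (forall_ (J := Σ j, Fin (N j)) hn.lift
    (((common hH' hx' hy' hu).and_ ((common hH' hx' hy' hv).and_ (eq_fin hu hv).not_)).not_.or_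
      (lookup hH' hu hv)))).bit_congr fun j => ?_
  unfold CommonClique
  refine forall_congr' fun a => forall_congr' fun b => ?_
  tauto

open Classical in
theorem if_ (hP : Computes N v (fun j => bit (P j))) (hw : Computes N v w)
    (hu : Computes N v u) : Computes N v (fun j => if P j then w j else u j) :=
  (hP.ite hw hu).congr fun j => by by_cases h : P j <;> simp [h]

theorem tryRemove (hn : Computes N v (fun j => num (N j)))
    (hG : Computes N v (fun j => encodeGraph (G j)))
    (hH : Computes N v (fun j => encodeGraph (H j)))
    (hx : Computes N v (fun j => num (x j))) (hy : Computes N v (fun j => num (y j))) :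
    Computes N v (fun j => encodeGraph (SimpleGraph.tryRemove (G j) (x j) (y j) (H j))) :=
  (if_ ((lookup hH hx hy).and_ ((lookup hG hx hy).not_.and_ (commonClique hn hH hx hy)))
    (flip hn hH hx hy) hH).congr fun j => by
      unfold SimpleGraph.tryRemove Removable
      split_ifs <;> rfl

theorem removePass (hn : Computes N v (fun j => num (N j)))
    (hG : Computes N v (fun j => encodeGraph (G j)))
    (hH : Computes N v (fun j => encodeGraph (H j))) :
    Computes N v (fun j => encodeGraph (SimpleGraph.removePass (G j) (H j))) := by
  refine fold (β := fun j => SimpleGraph (Fin (N j))) (fun _ => encodeGraph) _ H hn hH ?_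
  refine fold (J := Σ j, Fin (N j) × SimpleGraph (Fin (N j)))
    (β := fun x => SimpleGraph (Fin (N x.1))) (fun _ => encodeGraph) _ _ hn.liftGraph id.tl.hd ?_
  -- The input now lists the inner index, the current graph, the outer index, the outer graph and
  -- `v`.
  exact tryRemove hn.liftGraph.liftGraph hG.liftGraph.liftGraph id.tl.hd id.tl.tl.hd id.hd

theorem minimize (hn : Computes N v (fun j => num (N j)))
    (hG : Computes N v (fun j => encodeGraph (G j)))
    (hH : Computes N v (fun j => encodeGraph (H j))) :
    Computes N v (fun j => encodeGraph (SimpleGraph.minimize (G j) (H j))) := by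
  refine fold (β := fun j => SimpleGraph (Fin (N j))) (fun _ => encodeGraph) _ H hn hH ?_
  refine fold (J := Σ j, Fin (N j) × SimpleGraph (Fin (N j)))
    (β := fun x => SimpleGraph (Fin (N x.1))) (fun _ => encodeGraph) _ _ hn.liftGraph id.tl.hd ?_
  exact removePass hn.liftGraph.liftGraph hG.liftGraph.liftGraph id.tl.hd

theorem neighbor (hn : Computes N v (fun j => num (N j)))
    (hG : Computes N v (fun j => encodeGraph (G j)))
    (hH : Computes N v (fun j => encodeGraph (H j)))
    (hx : Computes N v (fun j => num (x j))) (hy : Computes N v (fun j => num (y j))) :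
    Computes N v (fun j => encodeGraph (SimpleGraph.neighbor (G j) (H j) (x j) (y j))) := by
  refine minimize hn hG ?_
  exact (if_ ((lookup hH hx hy).and_ (lookup hG hx hy).not_) (flip hn hH hx hy) hH).congr
    fun j => by split_ifs <;> rfl

theorem top (hn : Computes N v (fun j => num (N j))) :
    Computes N v (fun j => encodeGraph (⊤ : SimpleGraph (Fin (N j)))) :=
  graph hn ((eq_fin id.tl.hd id.hd).not_)

theorem sdiff (hn : Computes N v (fun j => num (N j)))
    (hG : Computes N v (fun j => encodeGraph (G j)))
    (hH : Computes N v (fun j => encodeGraph (H j))) :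
    Computes N v (fun j => encodeGraph (H j \ G j)) :=
  graph hn ((lookup hH.lift.lift id.tl.hd id.hd).and_ (lookup hG.lift.lift id.tl.hd id.hd).not_)

end Computes

/-! ### Trie keys of graphs and the expansion step -/

open Classical in
/-- The adjacency matrix as a list of bits. -/
noncomputable def keyBits {n : ℕ} (H : SimpleGraph (Fin n)) : List Bool :=
  (List.finRange n).foldr (fun x l => (List.finRange n).foldr
    (fun y l => decide (H.Adj x y) :: l) l) []

theorem foldr_cons_eq_append {α β : Type*} (f : α → β) (l : List α) (r : List β) :
    l.foldr (fun a r => f a :: r) r = l.map f ++ r := by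
  induction l with
  | nil => rfl
  | cons a l ih => simp [ih]

theorem length_keyBits {n : ℕ} (H : SimpleGraph (Fin n)) : (keyBits H).length = n * n := by
  classical
  have : ∀ l : List (Fin n), (l.foldr (fun x l => (List.finRange n).foldr
      (fun y l => decide (H.Adj x y) :: l) l) []).length = l.length * n := by
    intro l
    induction l with
    | nil => simp
    | cons a l ih =>
      rw [List.foldr_cons, foldr_cons_eq_append]
      simp only [List.length_append, List.length_map, List.length_finRange, List.length_cons, ih]
      ring
  have h := this (List.finRange n)
  rw [List.length_finRange] at h
  unfold keyBits
  convert h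

theorem keyBits_injective {n : ℕ} {H K : SimpleGraph (Fin n)} (h : keyBits H = keyBits K) :
    H = K := by
  classical
  have : ∀ l : List (Fin n),
      l.foldr (fun x l => (List.finRange n).foldr (fun y l => decide (H.Adj x y) :: l) l) [] =
      l.foldr (fun x l => (List.finRange n).foldr (fun y l => decide (K.Adj x y) :: l) l) [] →
      ∀ x ∈ l, ∀ y, H.Adj x y ↔ K.Adj x y := by
    intro l
    induction l with
    | nil => simp
    | cons a l ih =>
      rw [List.foldr_cons, List.foldr_cons, foldr_cons_eq_append, foldr_cons_eq_append]
      intro h x hx y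
      obtain ⟨h1, h2⟩ := List.append_inj h (by simp)
      rcases List.mem_cons.1 hx with rfl | hx
      · simpa using List.map_inj_left.1 h1 y (List.mem_finRange y)
      · exact ih h2 x hx y
  ext x y
  refine this (List.finRange n) ?_ x (List.mem_finRange x) y
  unfold keyBits at h
  convert h

namespace Computes

variable {J : Type} {N : J → ℕ} {v w u : J → Data} {G H : ∀ j, SimpleGraph (Fin (N j))}

theorem keyBits (hn : Computes N v (fun j => num (N j)))
    (hH : Computes N v (fun j => encodeGraph (H j))) :
    Computes N v (fun j => encodeBits (keyBits (H j))) := by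
  refine fold (β := fun _ => List Bool) (fun _ => encodeBits) _ _ hn nil ?_
  refine fold (J := Σ j, Fin (N j) × List Bool)
    (β := fun _ => List Bool) (fun _ => encodeBits) _ _
    (hn.liftFold fun _ => encodeBits) id.tl.hd ?_
  exact (lookup ((hH.liftFold fun _ => encodeBits).liftFold fun _ => encodeBits) id.tl.tl.hd id.hd).cons id.tl.hd

end Computes

open Classical in
/-- Push a graph on the stack and mark it in the trie, unless it has been marked before. -/
noncomputable def visit {n : ℕ} (K : SimpleGraph (Fin n)) (b : List (SimpleGraph (Fin n)) × Data) :
    List (SimpleGraph (Fin n)) × Data :=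
  if trieGet (keyBits K) b.2 = nil then (K :: b.1, trieInsert (keyBits K) b.2) else b

/-- Visit all neighbours of `H`. -/
noncomputable def expand {n : ℕ} (G H : SimpleGraph (Fin n))
    (b : List (SimpleGraph (Fin n)) × Data) : List (SimpleGraph (Fin n)) × Data :=
  (List.finRange n).foldr (fun x b => (List.finRange n).foldr
    (fun y b => visit (SimpleGraph.neighbor G H x y) b) b) b

/-- A stack and a trie as a tree. -/
noncomputable def encodeStack {n : ℕ} (b : List (SimpleGraph (Fin n)) × Data) : Data :=
  cons (ofList (b.1.map encodeGraph)) b.2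

namespace Computes

variable {J : Type} {N : J → ℕ} {v w u : J → Data} {G H : ∀ j, SimpleGraph (Fin (N j))}
  {b : ∀ j, List (SimpleGraph (Fin (N j))) × Data}

theorem visit (hn : Computes N v (fun j => num (N j)))
    (hH : Computes N v (fun j => encodeGraph (H j)))
    (hb : Computes N v (fun j => encodeStack (b j))) :
    Computes N v (fun j => encodeStack (visit (H j) (b j))) := by
  have hq : ∀ j, (TreeProg.keyBits (H j)).length ≤ (Polynomial.X * Polynomial.X : Polynomial ℕ).eval (N j) :=
    fun j => by simp [length_keyBits]
  refine ((trieGet_ _ hq (keyBits hn hH) hb.tl).ite hb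
    ((hH.cons hb.hd).cons (trieInsert_ _ hq (keyBits hn hH) hb.tl))).congr fun j => ?_
  by_cases h : trieGet (TreeProg.keyBits (H j)) (b j).2 = Data.nil
  · rw [TreeProg.visit, if_pos h]
    exact if_pos h
  · rw [TreeProg.visit, if_neg h]
    exact if_neg h

theorem expand (hn : Computes N v (fun j => num (N j)))
    (hG : Computes N v (fun j => encodeGraph (G j)))
    (hH : Computes N v (fun j => encodeGraph (H j)))
    (hb : Computes N v (fun j => encodeStack (b j))) :
    Computes N v (fun j => encodeStack (expand (G j) (H j) (b j))) := by
  let enc (j : J) : List (SimpleGraph (Fin (N j))) × Data → Data := encodeStack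
  let enc' (x : Σ j, Fin (N j) × List (SimpleGraph (Fin (N j))) × Data) :
    List (SimpleGraph (Fin (N x.1))) × Data → Data := encodeStack
  refine fold enc _ b hn hb (fold enc' _ _ (hn.liftFold enc) id.tl.hd ?_)
  have hn' := (hn.liftFold enc).liftFold enc'
  exact visit hn' (neighbor hn' ((hG.liftFold enc).liftFold enc') ((hH.liftFold enc).liftFold enc')
    id.tl.tl.hd id.hd) id.tl.hd

end Computes

end TreeProg

/-! ### Correctness, delay and space of the search -/

namespace TreeProg

open Data SimpleGraph

theorem Expr.allocs_le_cost (e : Expr) : e.allocs ≤ e.cost := by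
  induction e <;> simp only [Expr.allocs, Expr.cost] <;> omega

theorem Exec.cells_le {c : Cmd} {s t : State} (h : Exec c s t) :
    t.cells + s.time ≤ s.cells + t.time := by
  induction h with
  | skip s => exact le_rfl
  | assign x e s => have := e.allocs_le_cost; simp only [State.assign]; omega
  | output e s => have := e.allocs_le_cost; simp only [State.output]; omega
  | seq _ _ ih1 ih2 => omega
  | @ite_true e c d s t _ _ ih => have := e.allocs_le_cost; simp only [State.charge] at ih; omega
  | @ite_false e c d s t _ _ ih => have := e.allocs_le_cost; simp only [State.charge] at ih; omega
  | loop_stop _ =>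
    rename_i e _ _ _
    have := e.allocs_le_cost; simp only [State.charge]; omega
  | @loop_step e c s t u _ _ _ ih1 ih2 =>
    have := e.allocs_le_cost; simp only [State.charge] at ih1; omega

theorem size_ofList_le (l : List Data) (b : ℕ) (h : ∀ d ∈ l, d.size ≤ b) :
    (ofList l).size ≤ 1 + l.length * (1 + b) := by
  induction l with
  | nil => simp [ofList, size]
  | cons a l ih =>
    have h1 := ih fun d hd => h d (List.mem_cons_of_mem _ hd)
    have h2 := h a List.mem_cons_self
    simp only [ofList, size, List.length_cons, Nat.succ_mul]
    omega

theorem size_encodeGraph_le {n : ℕ} (H : SimpleGraph (Fin n)) :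
    (encodeGraph H).size ≤ 1 + n * (1 + (1 + n * (1 + 3))) := by
  classical
  refine (size_ofList_le _ (1 + n * (1 + 3)) fun d hd => ?_).trans (by simp)
  obtain ⟨i, rfl⟩ := (List.mem_ofFn' _ _).1 hd
  refine (size_ofList_le _ 3 fun d hd => ?_).trans (by simp)
  obtain ⟨j, rfl⟩ := (List.mem_ofFn' _ _).1 hd
  by_cases hij : H.Adj i j <;> simp [hij, ofBool, size]

/-- Summing the delays turns the delay bound into a bound on total running time. -/
theorem le_of_isChain {d a t : ℕ} {l : List ℕ}
    (h : List.IsChain (fun a b : ℕ => b ≤ a + d) (a :: (l ++ [t]))) :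
    t ≤ a + (l.length + 1) * d := by
  induction l generalizing a with
  | nil => simpa using h
  | cons b l ih =>
    rw [List.cons_append, List.isChain_cons_cons] at h
    have := ih h.2
    have h1 := h.1
    simp only [List.length_cons, Nat.succ_mul] at this ⊢
    omega

/-- Step `i` creates `P i` and no later step destroys it. -/
theorem foldr_establish {α ι : Type*} (f : ι → α → α) (P : ι → α → Prop)
    (hf : ∀ i a, P i (f i a)) (hm : ∀ i k a, P k a → P k (f i a)) (l : List ι) (a : α) :
    ∀ i ∈ l, P i (l.foldr f a) := by
  induction l with
  | nil => simp
  | cons b l ih =>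
    intro i hi
    rcases List.mem_cons.1 hi with rfl | hi
    · exact hf _ _
    · exact hm _ _ _ (ih i hi)

section Search

variable {n : ℕ} {G H K : SimpleGraph (Fin n)} {O : List (SimpleGraph (Fin n))}
  {b : List (SimpleGraph (Fin n)) × Data}

/-- `K` has been marked in the trie. -/
def Marked (b : List (SimpleGraph (Fin n)) × Data) (K : SimpleGraph (Fin n)) : Prop :=
  trieGet (keyBits K) b.2 ≠ nil

/-- The search invariant: `O` lists the graphs already output, `b.1` the graphs waiting. -/
structure SearchInv (G : SimpleGraph (Fin n)) (O : List (SimpleGraph (Fin n)))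
    (b : List (SimpleGraph (Fin n)) × Data) : Prop where
  marked : ∀ K, Marked b K ↔ K ∈ b.1 ++ O
  nodup : (b.1 ++ O).Nodup
  minimal : ∀ K ∈ b.1 ++ O, IsMinimalTriangulation G K

theorem marked_visit : Marked (visit K b) H ↔ H = K ∨ Marked b H := by
  unfold visit
  split_ifs with h
  · unfold Marked
    rw [trieGet_trieInsert _ _ _ (by simp [length_keyBits])]
    exact or_congr_left ⟨keyBits_injective, fun h => h ▸ rfl⟩
  · exact ⟨Or.inr, fun h' => h'.elim (fun h' => h' ▸ h) _root_.id⟩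

theorem SearchInv.visit (h : SearchInv G O b) (hK : IsMinimalTriangulation G K) :
    SearchInv G O (visit K b) := by
  by_cases hm : trieGet (keyBits K) b.2 = nil
  · have hK' : K ∉ b.1 ++ O := fun hc => (h.marked K).2 hc hm
    have hv : (TreeProg.visit K b).1 = K :: b.1 := by unfold TreeProg.visit; rw [if_pos hm]
    constructor
    · intro L
      rw [marked_visit, h.marked, hv]
      simp
    · rw [hv]; exact List.nodup_cons.2 ⟨hK', h.nodup⟩
    · rw [hv]
      intro L hL
      rcases List.mem_cons.1 hL with rfl | hL
      · exact hK
      · exact h.minimal L hL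
  · have hv : TreeProg.visit K b = b := by unfold TreeProg.visit; rw [if_neg hm]
    rwa [hv]

theorem SearchInv.expand (h : SearchInv G O b) (hH : IsMinimalTriangulation G H) :
    SearchInv G O (expand G H b) :=
  foldr_invariant _ (SearchInv G O) (fun x b h => foldr_invariant _ (SearchInv G O)
    (fun y _ h => h.visit (isMinimalTriangulation_neighbor hH x y)) _ b h) _ b h

theorem Marked.expand (h : Marked b K) : Marked (expand G H b) K :=
  foldr_invariant _ (Marked · K) (fun _ b h => foldr_invariant _ (Marked · K)
    (fun _ _ h => marked_visit.2 (Or.inr h)) _ b h) _ b h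

theorem marked_expand_neighbor (x y : Fin n) :
    Marked (expand G H b) (SimpleGraph.neighbor G H x y) := by
  refine foldr_establish _ (fun x b => ∀ y, Marked b (SimpleGraph.neighbor G H x y)) ?_ ?_ _ b x
    (List.mem_finRange x) y
  · intro x b y
    exact foldr_establish _ (fun y b => Marked b (SimpleGraph.neighbor G H x y))
      (fun y b => marked_visit.2 (Or.inl rfl)) (fun _ _ _ h => marked_visit.2 (Or.inr h)) _ b y
      (List.mem_finRange y)
  · intro i x b h y
    exact foldr_invariant _ (Marked · _) (fun _ _ h => marked_visit.2 (Or.inr h)) _ b (h y)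

theorem searchInv_init (G : SimpleGraph (Fin n)) :
    SearchInv G [] (visit (SimpleGraph.minimize G ⊤) ([], nil)) := by
  refine SearchInv.visit ⟨fun K => ?_, by simp, by simp⟩ (isMinimalTriangulation_minimize_top G)
  simp [Marked, trieGet_nil]

theorem SearchInv.pop {S : List (SimpleGraph (Fin n))} {T : Data}
    (h : SearchInv G O (H :: S, T)) : SearchInv G (H :: O) (S, T) := by
  have hp : (S ++ H :: O).Perm ((H :: S) ++ O) := List.perm_middle
  exact ⟨fun K => (h.marked K).trans hp.mem_iff.symm, hp.nodup_iff.2 h.nodup,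
    fun K hK => h.minimal K (hp.mem_iff.1 hK)⟩

end Search

/-- The state of the search as a tree. -/
noncomputable def encodeSearch {n : ℕ} (G : SimpleGraph (Fin n))
    (b : List (SimpleGraph (Fin n)) × Data) : Data :=
  cons (encodeStack b) (cons (encodeGraph G) (num n))

theorem computes_init : Computes (J := Σ n, SimpleGraph (Fin n)) (fun j => j.1)
    (fun j => encodeGraph j.2)
    (fun j => encodeSearch j.2 (visit (SimpleGraph.minimize j.2 ⊤) ([], nil))) := by
  have hn : Computes (J := Σ n, SimpleGraph (Fin n)) (fun j => j.1) (fun j => encodeGraph j.2)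
      (fun j => num j.1) :=
    (Computes.num_length (q := Polynomial.X) (fun j => by simp) Computes.id).congr
      fun j => by rw [List.length_ofFn]
  exact (Computes.visit (b := fun _ => ([], nil)) hn
    (Computes.minimize hn Computes.id (Computes.top hn))
    (Computes.nil.cons Computes.nil)).cons (Computes.id.cons hn)

theorem computes_output :
    Computes (J := Σ n, SimpleGraph (Fin n) × SimpleGraph (Fin n) × List (SimpleGraph (Fin n)) × Data)
    (fun j => j.1) (fun j => encodeSearch j.2.1 (j.2.2.1 :: j.2.2.2.1, j.2.2.2.2))
    (fun j => encodeGraph (j.2.2.1 \ j.2.1)) :=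
  Computes.sdiff Computes.id.tl.tl Computes.id.tl.hd Computes.id.hd.hd.hd

theorem computes_expand :
    Computes (J := Σ n, SimpleGraph (Fin n) × SimpleGraph (Fin n) × List (SimpleGraph (Fin n)) × Data)
    (fun j => j.1) (fun j => encodeSearch j.2.1 (j.2.2.1 :: j.2.2.2.1, j.2.2.2.2))
    (fun j => encodeSearch j.2.1 (expand j.2.1 j.2.2.1 (j.2.2.2.1, j.2.2.2.2))) :=
  (Computes.expand (J := Σ n, SimpleGraph (Fin n) × SimpleGraph (Fin n) × List (SimpleGraph (Fin n)) × Data)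
    (N := fun j => j.1) (b := fun j => (j.2.2.2.1, j.2.2.2.2)) Computes.id.tl.tl Computes.id.tl.hd
    Computes.id.hd.hd.hd (Computes.id.hd.hd.tl.cons Computes.id.hd.tl)).cons Computes.id.tl

/-- The search loop outputs the remaining minimal triangulations with the stated delay. -/
theorem exec_search {n : ℕ} (G : SimpleGraph (Fin n)) (c e : Cmd) (pc pe D d : ℕ)
    (hc : ∀ (H : SimpleGraph (Fin n)) (S : List (SimpleGraph (Fin n))) (T : Data) (s : State),
      s.vars 0 = encodeSearch G (H :: S, T) → ∃ s', Exec c s s' ∧ s'.vars 1 = encodeGraph (H \ G) ∧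
        s'.vars 0 = s.vars 0 ∧ s'.time ≤ s.time + pc ∧ s'.out = s.out)
    (he : ∀ (H : SimpleGraph (Fin n)) (S : List (SimpleGraph (Fin n))) (T : Data) (s : State),
      s.vars 0 = encodeSearch G (H :: S, T) → ∃ s', Exec e s s' ∧
        s'.vars 0 = encodeSearch G (expand G H (S, T)) ∧ s'.time ≤ s.time + pe ∧ s'.out = s.out)
    (hD : pe ≤ D) (hDd : D + pc + 6 + (1 + n * (1 + (1 + n * (1 + 3)))) ≤ d)
    (k : ℕ) (O : List (SimpleGraph (Fin n))) (hk : Nat.card (SimpleGraph (Fin n)) ≤ O.length + k)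
    (b : List (SimpleGraph (Fin n)) × Data) (hb : SearchInv G O b)
    (h0 : Marked b (SimpleGraph.minimize G ⊤))
    (hcl : ∀ H ∈ O, ∀ x y, Marked b (SimpleGraph.neighbor G H x y))
    (s : State) (hs : s.vars 0 = encodeSearch G b) (a : ℕ) (ha : s.time ≤ a + D) :
    ∃ (s' : State) (o : List (ℕ × Data)) (M : List (SimpleGraph (Fin n))),
      Exec (Cmd.loop (Expr.hd (Expr.hd (Expr.var 0)))
        (Cmd.seq c (Cmd.seq (Cmd.output (Expr.var 1)) e))) s s' ∧
      s'.out = s.out ++ o ∧ o.map Prod.snd = M.map (fun H => encodeGraph (H \ G)) ∧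
      (M.reverse ++ O).Nodup ∧ (∀ H, H ∈ M.reverse ++ O ↔ IsMinimalTriangulation G H) ∧
      List.IsChain (fun a b : ℕ => b ≤ a + d) (a :: (o.map Prod.fst ++ [s'.time])) := by
  -- With an empty stack the marked graphs are exactly those in `O`, so `O` contains the start, is
  -- closed under successors, and is complete by `mem_of_neighbor_closed`.
  have halt : ∀ (O : List (SimpleGraph (Fin n))) (T : Data), SearchInv G O ([], T) →
      Marked ([], T) (SimpleGraph.minimize G ⊤) →
      (∀ H ∈ O, ∀ x y, Marked ([], T) (SimpleGraph.neighbor G H x y)) →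
      ∀ (s : State), s.vars 0 = encodeSearch G ([], T) → ∀ a, s.time ≤ a + D →
      ∃ (s' : State) (o : List (ℕ × Data)) (M : List (SimpleGraph (Fin n))),
      Exec (Cmd.loop (Expr.hd (Expr.hd (Expr.var 0)))
        (Cmd.seq c (Cmd.seq (Cmd.output (Expr.var 1)) e))) s s' ∧
      s'.out = s.out ++ o ∧ o.map Prod.snd = M.map (fun H => encodeGraph (H \ G)) ∧
      (M.reverse ++ O).Nodup ∧ (∀ H, H ∈ M.reverse ++ O ↔ IsMinimalTriangulation G H) ∧
      List.IsChain (fun a b : ℕ => b ≤ a + d) (a :: (o.map Prod.fst ++ [s'.time])) := by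
    intro O T hb h0 hcl s hs a ha
    refine ⟨_, [], [], Exec.loop_stop ?_, by simp [State.charge], rfl, by simpa using hb.nodup,
      fun H => ⟨fun h => hb.minimal H (by simpa using h), fun h => ?_⟩, ?_⟩
    · simp [State.value, Expr.eval, hs, encodeSearch, encodeStack, hd, ofList]
    · refine mem_of_neighbor_closed {K | K ∈ O} (fun K hK => hb.minimal K hK)
        ((hb.marked _).1 h0) (fun K hK x y => (hb.marked _).1 (hcl K hK x y)) h
    · simp only [State.charge, Expr.cost, List.map_nil, List.nil_append, List.isChain_cons_cons,
        List.isChain_singleton, and_true]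
      omega
  induction k generalizing O b s a with
  | zero =>
    obtain ⟨_ | ⟨H, S⟩, T⟩ := b
    · exact halt O T hb h0 hcl s hs a ha
    · classical
      -- With no graphs left to output, a nonempty stack would give more distinct graphs than exist.
      have := hb.nodup.length_le_card
      rw [← Nat.card_eq_fintype_card] at this
      simp only [List.cons_append, List.length_cons, List.length_append] at this
      omega
  | succ k ih =>
    obtain ⟨_ | ⟨H, S⟩, T⟩ := b
    · exact halt O T hb h0 hcl s hs a ha
    have hH : IsMinimalTriangulation G H := hb.minimal H (by simp)
    obtain ⟨s1, e1, r1, v1, t1, o1⟩ := hc H S T (s.charge (Expr.hd (Expr.hd (Expr.var 0)))) hs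
    obtain ⟨s2, e2, r2, t2, o2⟩ := he H S T (s1.output (Expr.var 1)) (v1.trans hs)
    -- The constant 6 in `hDd` is the loop test (4) plus the overhead of the output (2). Expansion
    -- follows the output, so its cost falls into the next gap, where `D` allows for it.
    have hsize := size_encodeGraph_le (H \ G)
    have hout : (s1.output (Expr.var 1)).time = s1.time + (2 + (encodeGraph (H \ G)).size) := by
      simp [State.output, Expr.cost, State.value, Expr.eval, r1]
    simp only [State.charge, Expr.cost] at t1 o1
    obtain ⟨s3, o, M, e3, ho, hM, hnd, hmem, hch⟩ := ih (H :: O)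
      (by rw [List.length_cons]; omega) (expand G H (S, T)) (hb.pop.expand hH) (Marked.expand h0) (by
        intro K hK x y
        rcases List.mem_cons.1 hK with rfl | hK
        · exact marked_expand_neighbor x y
        · exact Marked.expand (hcl K hK x y)) s2 r2 (s1.output (Expr.var 1)).time (by omega)
    refine ⟨s3, ((s1.output (Expr.var 1)).time, encodeGraph (H \ G)) :: o, H :: M,
      Exec.loop_step ?_ (Exec.seq e1 (Exec.seq (Exec.output _ _) e2)) e3, ?_, by simp [hM],
      by simpa using hnd, by simpa using hmem, ?_⟩
    · simp [State.value, Expr.eval, hs, encodeSearch, encodeStack, hd, ofList]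
    · rw [ho, o2]
      simp [State.output, o1, Expr.cost, State.value, Expr.eval, r1]
    · rw [List.map_cons, List.cons_append, List.isChain_cons_cons]
      exact ⟨by simp only; omega, hch⟩

theorem length_le_of_nodup {n : ℕ} (M : List (SimpleGraph (Fin n))) (hM : M.Nodup) :
    M.length ≤ 2 ^ (n * n) := by
  classical
  have h := (hM.map (f := fun H : SimpleGraph (Fin n) => {p : Fin n × Fin n | H.Adj p.1 p.2}) (by
    intro H K h
    ext x y
    exact Set.ext_iff.1 h (x, y))).length_le_card
  simpa [Fintype.card_set] using h

/-- Here `S` is the input size and `D` the delay; each is below its own power of two, and `L + 1 ≤ 2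
^ (m + 1)`. -/
theorem space_bound (m S D t L : ℕ) (hL : L ≤ 2 ^ m) (ht : t ≤ (L + 1) * D) :
    S + t ≤ 2 ^ (m + 1 + S + D) := by
  have h1 : S < 2 ^ S := Nat.lt_two_pow_self
  have h2 : D < 2 ^ D := Nat.lt_two_pow_self
  have h3 : 1 ≤ 2 ^ m := Nat.one_le_two_pow
  have h4 : (L + 1) * D ≤ 2 ^ (m + 1) * D := Nat.mul_le_mul_right _ (by rw [pow_succ]; omega)
  have h5 : S ≤ 2 ^ (m + 1) * S := Nat.le_mul_of_pos_left _ (by positivity)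
  have h6 : S + D ≤ 2 ^ S * 2 ^ D := by nlinarith
  calc S + t ≤ 2 ^ (m + 1) * (S + D) := by rw [mul_add]; omega
    _ ≤ 2 ^ (m + 1) * (2 ^ S * 2 ^ D) := Nat.mul_le_mul_left _ h6
    _ = 2 ^ (m + 1 + S + D) := by rw [pow_add _ (m + 1 + S), pow_add _ (m + 1)]; ring

end TreeProg

open TreeProg in
/-- One program enumerates, for every finite graph, its minimal chordal completions, each exactly
once, with polynomial delay and in exponential space (all memory cells ever allocated are
counted, and so is the input). -/
theorem mainTheorem4 :
    ∃ (P : TreeProg.Cmd) (p q : Polynomial ℕ),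
      ∀ (n : ℕ) (G : SimpleGraph (Fin n)),
        ∃ (s : TreeProg.State) (L : List (Set (Sym2 (Fin n)))),
          TreeProg.Exec P (TreeProg.State.init (TreeProg.encodeGraph G)) s ∧
          s.out.map Prod.snd = L.map TreeProg.encodeEdges ∧
          L.Nodup ∧
          (∀ F : Set (Sym2 (Fin n)), F ∈ L ↔ IsMinimalChordalCompletion G F) ∧
          TreeProg.HasDelay (p.eval n) s ∧
          (TreeProg.encodeGraph G).size + s.cells ≤ 2 ^ (q.eval n) := by
  obtain ⟨c0, p0, h0⟩ := computes_init
  obtain ⟨c1, p1, h1⟩ := computes_output.call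
  obtain ⟨c2, p2, h2⟩ := computes_expand
  let sz : Polynomial ℕ := 1 + Polynomial.X * (1 + (1 + Polynomial.X * (1 + 3)))
  -- The sum `p0 + p2` plays the role of `D`: it covers the initialization before the first loop
  -- test and an expansion before each later one.
  let p : Polynomial ℕ := p0 + p2 + p1 + 6 + sz
  refine ⟨Cmd.seq (c0 0) (Cmd.loop (Expr.hd (Expr.hd (Expr.var 0)))
    (Cmd.seq (c1 0 1) (Cmd.seq (Cmd.output (Expr.var 1)) (c2 0)))), p,
    Polynomial.X * Polynomial.X + 1 + sz + p, fun n G => ?_⟩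
  have hsz : sz.eval n = 1 + n * (1 + (1 + n * (1 + 3))) := by simp [sz]
  obtain ⟨s0, e0, r0, -, t0, o0⟩ := h0 ⟨n, G⟩ 0 (State.init (encodeGraph G)) rfl
  obtain ⟨s, o, M, e, ho, hM, hnd, hmem, hch⟩ := exec_search G (c1 0 1) (c2 0) (p1.eval n)
    (p2.eval n) (p0.eval n + p2.eval n) (p.eval n)
    (fun H S T s hs => by
      obtain ⟨s', a1, a2, a3, a4, a5⟩ := h1 ⟨n, G, H, S, T⟩ 0 1 s hs
      exact ⟨s', a1, a2, a3 0 one_pos, a4, a5⟩)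
    (fun H S T s hs => by
      obtain ⟨s', a1, a2, a3, a4, a5⟩ := h2 ⟨n, G, H, S, T⟩ 0 s hs
      exact ⟨s', a1, a2, a4, a5⟩)
    (Nat.le_add_left _ _) (by simp [p, hsz]) (Nat.card (SimpleGraph (Fin n))) [] (by simp) _
    (searchInv_init G) (marked_visit.2 (Or.inl rfl)) (by simp) s0 r0 0
    (by simp only [State.init] at t0; omega)
  have o0' : s0.out = [] := o0
  rw [o0', List.nil_append] at ho
  have hMnd : M.Nodup := by simpa using hnd
  have hMmem : ∀ H, H ∈ M ↔ SimpleGraph.IsMinimalTriangulation G H := by simpa using hmem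
  refine ⟨s, M.map fun H => (H \ G).edgeSet, Exec.seq e0 e, ?_, ?_, fun F => ?_, ?_, ?_⟩
  · rw [ho, hM, List.map_map]
    refine List.map_congr_left fun H _ => ?_
    rw [Function.comp_apply, encodeEdges, SimpleGraph.fromEdgeSet_edgeSet]
  · refine hMnd.map_on fun H hH K hK h => ?_
    have h' := SimpleGraph.edgeSet_injective h
    rw [← sup_sdiff_cancel_right ((hMmem H).1 hH).1.1, h',
      sup_sdiff_cancel_right ((hMmem K).1 hK).1.1]
  · rw [SimpleGraph.isMinimalChordalCompletion_iff, List.mem_map]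
    exact exists_congr fun H => and_congr (hMmem H) eq_comm
  · rw [HasDelay, ho]
    exact hch
  · have hcells : s.cells ≤ s.time := by
      have := (Exec.seq e0 e).cells_le
      simp only [State.init] at this
      omega
    have hlen : o.length = M.length := by simpa using congrArg List.length hM
    have htime := le_of_isChain hch
    rw [List.length_map, hlen, zero_add] at htime
    have hb := space_bound (n * n) (sz.eval n) (p.eval n) s.time M.length
      (length_le_of_nodup M hMnd) htime
    have hs := size_encodeGraph_le G
    simp only [Polynomial.eval_add, Polynomial.eval_mul, Polynomial.eval_X, Polynomial.eval_one] at hb ⊢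
    omega
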